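/- There is a constant $C>0$ such that for every $n\ge 0$ the following holds (with $\log 0:=0$). For $a,b\in\mathbb R^n$ write $x=(a_1,\dots,a_n,b_1,\dots,b_n)\in\mathbb R^{2n}$, let $e_1,\dots,e_n,f_1,\dots,f_n$ be the standard basis of $\mathbb R^{2n}$, and let $$H_n=\{(e_i+f_j)-(e_k+f_l): i,j,k,l\in[n]\}.$$ There is a deterministic ternary decision tree $T_n$ (depending only on $n$), each of whose inner nodes queries the sign in $\{-,0,+\}$ of a linear form $\langle q,x\rangle$, such that: 1. each query $q$ is either an element of $H_n$ (a comparison "$a_i+b_j \ge a_k+b_l$?" of two elements of $A+B$) or a difference $h'-h''$ with $h',h''\in H_n$ (a differences-comparison "$a_i+b_j-a_{i'}-b_{j'}\ge a_k+b_l-a_{k'}-b_{l'}$?"); 2. each query $q$ has at most $8$ nonzero coefficients, and all its coefficients lie in $\{-1,0,1\}$; 3. the depth of $T_n$ (the maximal number of queries on a root-to-leaf path) is at most $C\,n\log^2 n$; 4. for every $x\in\mathbb R^{2n}$, the tree outputs $\bigl(\operatorname{sign}\langle h,x\rangle\bigr)_{h\in H_n}$, that is, the outcomes of all comparisons between $a_i+b_j$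 and $a_k+b_l$, $i,j,k,l\in[n]$; 5. consequently $T_n$ sorts sumsets: from the output of $T_n$ alone, with no further access to the input, one reads off a list of index pairs $(i,j)$ such that, whenever $A,B\subset\mathbb R$ have size $n$ and $A=\{a_1,\dots,a_n\}$, $B=\{b_1,\dots,b_n\}$, the corresponding list of sums $a_i+b_j$ is exactly the list of the elements of $A+B=\{a+b:a\in A,\ b\in B\}$ in strictly increasing order. -/

import Mathlib

open scoped Pointwise

/-- A ternary linear decision tree on inputs `x : ι → ℝ`. An inner node carries a linear query `q`;
its three subtrees are used when `⟨q, x⟩` is negative, zero and positive respectively.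
A leaf carries the output. -/
inductive LinearDecisionTree (ι Out : Type) : Type
  | leaf (out : Out) : LinearDecisionTree ι Out
  | node (q : ι → ℝ) (neg zero pos : LinearDecisionTree ι Out) : LinearDecisionTree ι Out

namespace LinearDecisionTree

variable {ι Out : Type}

/-- The maximal number of queries on a path from the root to a leaf. -/
def depth : LinearDecisionTree ι Out → ℕ
  | leaf _ => 0
  | node _ neg zero pos => max neg.depth (max zero.depth pos.depth) + 1

/-- The output of the tree on input `x`; the input is accessed only through the signs
of the queries along the path. -/
noncomputable def eval [Fintype ι] : LinearDecisionTree ι Out → (ι → ℝ) → Out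
  | leaf out, _ => out
  | node q neg zero pos, x =>
    match SignType.sign (q ⬝ᵥ x) with
    | SignType.neg => neg.eval x
    | SignType.zero => zero.eval x
    | SignType.pos => pos.eval x

/-- The set of all queries that occur at the inner nodes of the tree. -/
def queries : LinearDecisionTree ι Out → Set (ι → ℝ)
  | leaf _ => ∅
  | node q neg zero pos => {q} ∪ neg.queries ∪ zero.queries ∪ pos.queries

/-- The tree is a comparison decision tree with respect to `H`: every query is a label query
`h ∈ H` or a comparison query `h' - h''` with `h', h'' ∈ H`. -/
def IsComparisonTree (H : Set (ι → ℝ)) (T : LinearDecisionTree ι Out) : Prop :=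
  ∀ q ∈ T.queries, q ∈ H ∨ ∃ h' ∈ H, ∃ h'' ∈ H, q = h' - h''

end LinearDecisionTree

/-- The point-location function of `H`: the signs of `⟨h, x⟩` for all `h ∈ H`. -/
noncomputable def pointLocation {ι : Type} [Fintype ι] (H : Set (ι → ℝ)) (x : ι → ℝ) :
    H → SignType :=
  fun h => SignType.sign (h.1 ⬝ᵥ x)

/-- A vector is `s`-sparse if at most `s` of its coefficients are nonzero. -/
def IsSparse {ι : Type} (s : ℕ) (q : ι → ℝ) : Prop :=
  (Function.support q).encard ≤ s

/-- The coefficient vector of `(a i + b j) - (a k + b l)`, where the coordinates `Sum.inl` of the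
input stand for `a` and the coordinates `Sum.inr` stand for `b`. -/
def sumComparison {n : ℕ} (i j k l : Fin n) : Fin n ⊕ Fin n → ℝ :=
  (Pi.single (Sum.inl i) 1 + Pi.single (Sum.inr j) 1)
    - (Pi.single (Sum.inl k) 1 + Pi.single (Sum.inr l) 1)

/-- The vectors of all comparisons `a i + b j` versus `a k + b l` of two elements of `A + B`. -/
def sumsetVectors (n : ℕ) : Set (Fin n ⊕ Fin n → ℝ) :=
  {h | ∃ i j k l : Fin n, h = sumComparison i j k l}

/-!
The construction follows Kane, Lovett and Moran. Call a form inferred from a sample `S` at `x` if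
its sign at `x` is determined by the comparisons of the forms in `S` with each other and with zero.
Among more than a constant multiple of `d` sparse sign vectors in dimension `d`, some form is
inferred from the others: order them along `x`; the increments have more subset sums than there are
integer points in the box containing these sums, so two subset sums coincide, and this writes one
form as the sum of smaller forms and increments, whose signs are known. Double counting then shows
that a random sample of `O(d)` forms fails to infer half of the forms only with probability at most
`2⁻ᵈ`.

Differences of sign vectors are again sign vectors if both lie in the same orthant, and some orthant
contains a `2⁻ˢ` fraction of any collection of `s`-sparse vectors. Sampling and sorting forms from
this orthant with `O(d log d)` queries makes up a round. It settles a constant fraction of the open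
forms, unless `x` is one of the few points at which the sample fails; it then leaves only a `2⁻ᵈ`
fraction of a finite set of points representing the cells of the arrangement of all possible
queries. As there are `|H|^O(d)` cells, `O(log |H|)` rounds suffice.
-/

open SignType (sign)
open scoped Finset

section Sign

theorem sign_add_eq_of_sign_eq {G : Type*} [AddCommGroup G] [LinearOrder G] [IsOrderedAddMonoid G]
    {a b a' b' : G} (ha : sign a = sign a') (hb : sign b = sign b')
    (hab : sign a = -sign b → sign a = 0) : sign (a + b) = sign (a' + b') := by
  rcases lt_trichotomy a 0 with h | rfl | h
  · have h' : a' < 0 := by rwa [← sign_eq_neg_one_iff, ← ha, sign_eq_neg_one_iff]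
    have hb0 : b ≤ 0 := by
      by_contra! h0
      simp [sign_neg h, sign_pos h0] at hab
    have hb0' : b' ≤ 0 := by rwa [← sign_nonpos_iff, ← hb, sign_nonpos_iff]
    rw [sign_neg (add_neg_of_neg_of_nonpos h hb0), sign_neg (add_neg_of_neg_of_nonpos h' hb0')]
  · rw [sign_zero, eq_comm, sign_eq_zero_iff] at ha
    rw [ha, zero_add, zero_add, hb]
  · have h' : 0 < a' := by rwa [← sign_eq_one_iff, ← ha, sign_eq_one_iff]
    have hb0 : 0 ≤ b := by
      by_contra! h0
      simp [sign_pos h, sign_neg h0] at hab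
    have hb0' : 0 ≤ b' := by rwa [← sign_nonneg_iff, ← hb, sign_nonneg_iff]
    rw [sign_pos (add_pos_of_pos_of_nonneg h hb0), sign_pos (add_pos_of_pos_of_nonneg h' hb0')]

theorem abs_mul_add_abs_mul_eq_zero_of_sign_ne {R : Type*} [CommRing R] [LinearOrder R]
    [IsStrictOrderedRing R] {a b : R} (h : sign a ≠ sign b) : |b| * a + |a| * b = 0 := by
  rcases lt_trichotomy a 0 with ha | rfl | ha <;> rcases lt_trichotomy b 0 with hb | rfl | hb <;>
    simp_all [abs_of_neg, abs_of_pos, mul_comm]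

theorem sign_mul_add_mul_of_sign_eq {R : Type*} [CommRing R] [LinearOrder R]
    [IsStrictOrderedRing R] {c d u v : R} (hc : 0 ≤ c) (hd : 0 ≤ d) (hcd : 0 < c + d)
    (huv : sign u = sign v) : sign (c * u + d * v) = sign u := by
  have hsum : sign ((c + d) * u) = sign u := by rw [sign_mul, sign_pos hcd, one_mul]
  rw [← hsum, add_mul]
  refine sign_add_eq_of_sign_eq rfl ?_ ?_
  · rw [sign_mul, sign_mul, huv]
  · rw [sign_mul, sign_mul, ← huv]
    have hc' := sign_nonneg_iff.2 hc
    have hd' := sign_nonneg_iff.2 hd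
    revert hc' hd'
    generalize sign c = σ
    generalize sign d = τ
    generalize sign u = ρ
    decide +revert

end Sign

section SignCell

variable {ι : Type*} [Fintype ι] {S T X Y : Set (ι → ℝ)} {g h x y : ι → ℝ}

/-- The cell containing `x` of the arrangement of hyperplanes `g = 0`, `g ∈ S`: the points at which
every form in `S` has the same sign as at `x`. -/
def signCell (S : Set (ι → ℝ)) (x : ι → ℝ) : Set (ι → ℝ) :=
  {y | ∀ g ∈ S, sign (g ⬝ᵥ y) = sign (g ⬝ᵥ x)}

/-- The linear form `h` is resolved on the region `X`: its sign is the same at all points of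
`X`. -/
def SignConstOn (h : ι → ℝ) (X : Set (ι → ℝ)) : Prop :=
  ∀ x ∈ X, ∀ y ∈ X, sign (h ⬝ᵥ x) = sign (h ⬝ᵥ y)

theorem signCell_anti (hST : S ⊆ T) : signCell T x ⊆ signCell S x :=
  fun _ hy g hg => hy g (hST hg)

theorem signCell_eq_of_mem (hy : y ∈ signCell S x) : signCell S y = signCell S x :=
  Set.ext fun _ => forall₂_congr fun g hg => by rw [hy g hg]

theorem neg_mem_signCell_neg (hy : y ∈ signCell S x) : -y ∈ signCell S (-x) := fun g hg => by
  rw [dotProduct_neg, dotProduct_neg, Left.sign_neg, Left.sign_neg, hy g hg]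

theorem SignConstOn.mono (hh : SignConstOn h X) (hYX : Y ⊆ X) : SignConstOn h Y :=
  fun x hx y hy => hh x (hYX hx) y (hYX hy)

theorem SignConstOn.neg (hh : SignConstOn h X) : SignConstOn (-h) X := fun x hx y hy => by
  rw [neg_dotProduct, neg_dotProduct, Left.sign_neg, Left.sign_neg, hh x hx y hy]

theorem subset_signCell (hY : ∀ g ∈ S, SignConstOn g Y) (hx : x ∈ Y) : Y ⊆ signCell S x :=
  fun y hy g hg => hY g hg y hy x hx

theorem signConstOn_of_subsingleton (hX : X.Subsingleton) : SignConstOn h X :=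
  fun x hx y hy => by rw [hX hx hy]

end SignCell

namespace LinearDecisionTree

theorem eval_eq_of_mem_signCell {ι Out : Type} [Fintype ι] {x y : ι → ℝ} :
    ∀ T : LinearDecisionTree ι Out, y ∈ signCell T.queries x → T.eval y = T.eval x
  | leaf _, _ => rfl
  | node q neg zero pos, hy => by
    have hneg := neg.eval_eq_of_mem_signCell
      (signCell_anti (fun _ h => .inl (.inl (.inr h))) hy)
    have hzero := zero.eval_eq_of_mem_signCell (signCell_anti (fun _ h => .inl (.inr h)) hy)
    have hpos := pos.eval_eq_of_mem_signCell (signCell_anti (fun _ h => .inr h) hy)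
    simp only [eval, hy q (.inl (.inl (.inl rfl))), hneg, hzero, hpos]

end LinearDecisionTree

/-- The region `X` can be split with at most `D` adaptive queries from `Q` into regions that all
satisfy `P`. It plays the role of a decision tree whose leaves carry no output, so that trees can be
composed before their outputs are chosen. -/
inductive Refinable {ι : Type*} [Fintype ι] (Q : Set (ι → ℝ)) (P : Set (ι → ℝ) → Prop) :
    ℕ → Set (ι → ℝ) → Prop
  | done {D : ℕ} {X : Set (ι → ℝ)} (h : P X) : Refinable Q P D X
  | query {D : ℕ} {X : Set (ι → ℝ)} (q : ι → ℝ) (hq : q ∈ Q)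
      (h : ∀ s : SignType, Refinable Q P D {x ∈ X | sign (q ⬝ᵥ x) = s}) : Refinable Q P (D + 1) X

namespace Refinable

theorem mono_depth {ι : Type*} [Fintype ι] {Q : Set (ι → ℝ)} {P : Set (ι → ℝ) → Prop} {D D' : ℕ}
    {X : Set (ι → ℝ)} (h : Refinable Q P D X) (hD : D ≤ D') : Refinable Q P D' X := by
  induction h generalizing D' with
  | done h => exact done h
  | query q hq _ ih =>
    obtain ⟨E, rfl⟩ := Nat.exists_eq_add_of_le' (Nat.one_le_of_lt hD)
    exact query q hq fun s => ih s (Nat.le_of_succ_le_succ hD)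

theorem bind {ι : Type*} [Fintype ι] {Q : Set (ι → ℝ)} {P P' : Set (ι → ℝ) → Prop} {D D' : ℕ}
    {X : Set (ι → ℝ)} (h : Refinable Q P D X) (hP : ∀ Y ⊆ X, P Y → Refinable Q P' D' Y) :
    Refinable Q P' (D + D') X := by
  induction h with
  | done h => exact (hP _ subset_rfl h).mono_depth (Nat.le_add_left _ _)
  | @query D X q hq _ ih =>
    rw [Nat.add_right_comm]
    exact query q hq fun s => ih s fun Y hY => hP Y (hY.trans (Set.sep_subset _ _))

theorem exists_tree {ι Out : Type} [Fintype ι] {Q : Set (ι → ℝ)} {P : Set (ι → ℝ) → Prop} {D : ℕ}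
    {X : Set (ι → ℝ)} {F : (ι → ℝ) → Out} (h : Refinable Q P D X)
    (hP : ∀ Y, P Y → ∃ o, ∀ x ∈ Y, F x = o) :
    ∃ T : LinearDecisionTree ι Out, T.depth ≤ D ∧ T.queries ⊆ Q ∧ ∀ x ∈ X, T.eval x = F x := by
  induction h with
  | done h =>
    obtain ⟨o, ho⟩ := hP _ h
    exact ⟨.leaf o, Nat.zero_le _, Set.empty_subset _, fun x hx => (ho x hx).symm⟩
  | query q hq _ ih =>
    choose T hdepth hqueries heval using ih
    refine ⟨.node q (T .neg) (T .zero) (T .pos), ?_, ?_, fun x hx => ?_⟩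
    · exact Nat.succ_le_succ (max_le (hdepth _) (max_le (hdepth _) (hdepth _)))
    · simp only [LinearDecisionTree.queries, Set.union_subset_iff, Set.singleton_subset_iff]
      exact ⟨⟨⟨hq, hqueries _⟩, hqueries _⟩, hqueries _⟩
    · simp only [LinearDecisionTree.eval]
      split <;> exact heval _ x ⟨hx, ‹_›⟩

end Refinable

section Sorting

theorem exists_median {α β : Type*} [AddCommGroup β] [LinearOrder β] [IsOrderedAddMonoid β]
    {U : Finset α} (hU : U.Nonempty) (f : α → β) :
    ∃ g ∈ U, ∀ s : SignType, s ≠ 0 → 2 * #{u ∈ U | sign (f u - f g) = s} ≤ #U := by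
  have hne : {g ∈ U | #U ≤ 2 * #{u ∈ U | f u ≤ f g}}.Nonempty := by
    obtain ⟨t, ht, hmax⟩ := U.exists_max_image f hU
    refine ⟨t, Finset.mem_filter.2 ⟨ht, ?_⟩⟩
    rw [Finset.filter_true_of_mem hmax]
    omega
  obtain ⟨g, hg, hmin⟩ := Finset.exists_min_image _ f hne
  simp only [Finset.mem_filter] at hg hmin
  have habove : 2 * #{u ∈ U | f g < f u} ≤ #U := by
    have := Finset.card_filter_add_card_filter_not (s := U) fun u => f u ≤ f g
    simp only [not_le] at this
    omega
  have hbelow : 2 * #{u ∈ U | f u < f g} ≤ #U := by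
    by_contra! hlt
    obtain ⟨g', hg', hmax⟩ := Finset.exists_max_image {u ∈ U | f u < f g} f
      (Finset.card_pos.1 (by omega))
    have hcard : #{u ∈ U | f u < f g} ≤ #{u ∈ U | f u ≤ f g'} :=
      Finset.card_le_card fun u hu =>
        Finset.mem_filter.2 ⟨(Finset.mem_filter.1 hu).1, hmax u hu⟩
    rw [Finset.mem_filter] at hg'
    exact (hmin g' ⟨hg'.1, by omega⟩).not_gt hg'.2
  refine ⟨g, hg.1, fun s hs => ?_⟩
  cases s with
  | zero => exact absurd rfl hs
  | neg => simpa only [SignType.neg_eq_neg_one, sign_eq_neg_one_iff, sub_neg] using hbelow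
  | pos => simpa only [SignType.pos_eq_one, sign_eq_one_iff, sub_pos] using habove

variable {ι : Type*} [Fintype ι]

theorem signConstOn_sub_insert {S X : Set (ι → ℝ)} {h : ι → ℝ}
    (hS : ∀ g ∈ S - S, SignConstOn g X) (hh : ∀ u ∈ S, SignConstOn (h - u) X) :
    ∀ g ∈ insert h S - insert h S, SignConstOn g X := by
  rintro _ ⟨g, rfl | hg, k, rfl | hk, rfl⟩
  · intro x _ y _
    simp
  · exact hh k hk
  · simpa using (hh g hg).neg
  · exact hS _ (Set.sub_mem_sub hg hk)

/-- The comparison of `h` with `u` remains open only on the side of the pivot `g` on which `h`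
lies. -/
theorem sign_sub_eq_of_not_signConstOn {X : Set (ι → ℝ)} {g h u x₀ : ι → ℝ} {s : SignType}
    (hg : ∀ x ∈ X, sign ((h - g) ⬝ᵥ x) = s) (hgu : SignConstOn (g - u) X) (hx₀ : x₀ ∈ X)
    (hu : ¬SignConstOn (h - u) X) : s ≠ 0 ∧ sign (u ⬝ᵥ x₀ - g ⬝ᵥ x₀) = s := by
  contrapose! hu
  intro x hx y hy
  rw [← sub_add_sub_cancel h g u, add_dotProduct, add_dotProduct]
  refine sign_add_eq_of_sign_eq ((hg x hx).trans (hg y hy).symm) (hgu x hx y hy) fun hs => ?_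
  by_contra hs0
  rw [hg x hx] at hs hs0
  refine hu hs0 ?_
  rw [hs, ← hgu x₀ hx₀ x hx, ← Left.sign_neg, ← sub_dotProduct, ← neg_dotProduct, neg_sub]

open Classical in
/-- Binary search: querying the comparison with a median of the open ones halves their number. -/
theorem refinable_binary_search {Q : Set (ι → ℝ)} {S : Finset (ι → ℝ)} {h : ι → ℝ}
    (hQ : ∀ g ∈ S, h - g ∈ Q) {k : ℕ} {X : Set (ι → ℝ)}
    (hX : ∀ g ∈ (S - S : Set (ι → ℝ)), SignConstOn g X)
    (hcard : #{u ∈ S | ¬SignConstOn (h - u) X} < 2 ^ k) :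
    Refinable Q (fun Y => ∀ u ∈ S, SignConstOn (h - u) Y) k X := by
  induction k generalizing X with
  | zero => exact .done (by simpa using hcard)
  | succ k ih =>
    set U := {u ∈ S | ¬SignConstOn (h - u) X} with hU
    rcases U.eq_empty_or_nonempty with hempty | hne
    · exact .done (by simpa [hU, Finset.filter_eq_empty_iff] using hempty)
    rcases X.eq_empty_or_nonempty with rfl | ⟨x₀, hx₀⟩
    · exact .done fun u _ => signConstOn_of_subsingleton Set.subsingleton_empty
    obtain ⟨g, hgU, hmedian⟩ := exists_median hne fun u => u ⬝ᵥ x₀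
    have hgS : g ∈ S := (Finset.mem_filter.1 hgU).1
    refine .query (h - g) (hQ g hgS) fun s => ?_
    set X' := {x ∈ X | sign ((h - g) ⬝ᵥ x) = s}
    have hX' : X' ⊆ X := Set.sep_subset _ _
    rcases X'.eq_empty_or_nonempty with hempty | ⟨x₁, hx₁⟩
    · rw [hempty]
      exact .done fun u _ => signConstOn_of_subsingleton Set.subsingleton_empty
    have hside : ∀ u ∈ S, ¬SignConstOn (h - u) X' → s ≠ 0 ∧ sign (u ⬝ᵥ x₀ - g ⬝ᵥ x₀) = s := by
      intro u hu hopen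
      have hgu := hX _ (Set.sub_mem_sub (Finset.mem_coe.2 hu) (Finset.mem_coe.2 hgS))
      rw [← sub_dotProduct, hgu x₀ hx₀ x₁ (hX' hx₁), sub_dotProduct]
      refine sign_sub_eq_of_not_signConstOn (fun x hx => hx.2) ?_ hx₁ hopen
      simpa using (hgu.mono hX').neg
    refine ih (fun g hg => (hX g hg).mono hX') ?_
    rcases eq_or_ne s 0 with hs | hs
    · rw [Finset.filter_false_of_mem fun u hu hopen => (hside u hu hopen).1 hs]
      positivity
    · have hsub : {u ∈ S | ¬SignConstOn (h - u) X'} ⊆ {u ∈ U | sign (u ⬝ᵥ x₀ - g ⬝ᵥ x₀) = s} := by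
        intro u hu
        rw [Finset.mem_filter] at hu
        exact Finset.mem_filter.2 ⟨Finset.mem_filter.2 ⟨hu.1, fun hc => hu.2 (hc.mono hX')⟩,
          (hside u hu.1 hu.2).2⟩
      have := Finset.card_le_card hsub
      have := hmedian s hs
      rw [pow_succ] at hcard
      omega

theorem refinable_insertion_sort {Q : Set (ι → ℝ)} {k : ℕ} {S : Finset (ι → ℝ)}
    (hQ : ∀ g ∈ S, ∀ h ∈ S, g - h ∈ Q) (hcard : #S ≤ 2 ^ k) (X : Set (ι → ℝ)) :
    Refinable Q (fun Y => ∀ g ∈ (S - S : Set (ι → ℝ)), SignConstOn g Y) (#S * k) X := by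
  classical
  induction S using Finset.induction_on with
  | empty => exact .done (by simp)
  | insert h S hh ih =>
    rw [Finset.card_insert_of_notMem hh] at hcard ⊢
    rw [Nat.add_mul, one_mul]
    refine (ih (fun g hg k hk => hQ g (Finset.mem_insert_of_mem hg) k (Finset.mem_insert_of_mem hk))
      (Nat.le_of_succ_le hcard)).bind fun Y _ hY => ?_
    have hsearch := refinable_binary_search (Q := Q) (h := h)
      (fun g hg => hQ h (Finset.mem_insert_self _ _) g (Finset.mem_insert_of_mem hg)) hY
      ((Finset.card_filter_le _ _).trans_lt hcard)
    refine (Nat.add_zero k) ▸ hsearch.bind fun Z hZY hZ => .done ?_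
    rw [Finset.coe_insert]
    exact signConstOn_sub_insert (fun g hg => (hY g hg).mono hZY) hZ

end Sorting

section SignPatterns

theorem card_le_card_image_add_mul {α β : Type*} [DecidableEq β] {A : Finset α} {f : α → β}
    {C : Finset β} {k : ℕ}
    (hk : ∀ b, #{a ∈ A | f a = b} ≤ k + 1)
    (hC : ∀ a ∈ A, ∀ a' ∈ A, f a = f a' → a ≠ a' → f a ∈ C) :
    #A ≤ #(A.image f) + k * #C := by
  have hfibre : ∀ b, #{a ∈ A | f a = b} ≤ 1 + if b ∈ C then k else 0 := by
    intro b
    split_ifs with hb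
    · exact (hk b).trans (Nat.add_comm _ _).le
    · refine Finset.card_le_one.2 fun a ha a' ha' => ?_
      rw [Finset.mem_filter] at ha ha'
      by_contra hne
      exact hb (ha.2 ▸ hC a ha.1 a' ha'.1 (ha.2.trans ha'.2.symm) hne)
  calc #A = ∑ b ∈ A.image f, #{a ∈ A | f a = b} :=
        Finset.card_eq_sum_card_fiberwise fun _ => Finset.mem_image_of_mem f
    _ ≤ ∑ b ∈ A.image f, (1 + if b ∈ C then k else 0) := Finset.sum_le_sum fun b _ => hfibre b
    _ = #(A.image f) + #{b ∈ A.image f | b ∈ C} * k := by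
        rw [Finset.sum_add_distrib, ← Finset.sum_filter,
          Finset.sum_const, Finset.sum_const, smul_eq_mul, smul_eq_mul, mul_one]
    _ ≤ #(A.image f) + k * #C := by
        rw [Nat.mul_comm]
        gcongr
        exact fun b hb => (Finset.mem_filter.1 hb).2

variable {K V : Type*} [Field K] [LinearOrder K] [AddCommGroup V] [Module K V]

open Classical in
/-- The sign patterns that the linear forms `q i` realise simultaneously at points of `V`; they
label the cells of the corresponding hyperplane arrangement. -/
noncomputable def signPatterns {m : ℕ} (q : Fin m → Module.Dual K V) : Finset (Fin m → SignType) :=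
  {σ | ∃ x, ∀ i, sign (q i x) = σ i}

theorem mem_signPatterns {m : ℕ} {q : Fin m → Module.Dual K V} {σ : Fin m → SignType} :
    σ ∈ signPatterns q ↔ ∃ x, ∀ i, sign (q i x) = σ i := by
  simp [signPatterns]

theorem image_tail_signPatterns_subset {m : ℕ} (q : Fin (m + 1) → Module.Dual K V) :
    (signPatterns q).image Fin.tail ⊆ signPatterns (Fin.tail q) := by
  intro τ hτ
  obtain ⟨σ, hσ, rfl⟩ := Finset.mem_image.1 hτ
  obtain ⟨x, hx⟩ := mem_signPatterns.1 hσ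
  exact mem_signPatterns.2 ⟨x, fun i => hx i.succ⟩

variable [IsStrictOrderedRing K]

/-- The segment joining two points on different sides of the hyperplane `q = 0` meets it. -/
theorem exists_mem_ker_sign_eq {κ : Type*} {q : Module.Dual K V} {p : κ → Module.Dual K V} {x y : V}
    (hq : sign (q x) ≠ sign (q y)) (hp : ∀ i, sign (p i x) = sign (p i y)) :
    ∃ z ∈ LinearMap.ker q, ∀ i, sign (p i z) = sign (p i x) := by
  have hpos : 0 < |q y| + |q x| := by
    refine lt_of_le_of_ne (by positivity) fun h => hq ?_
    obtain ⟨hy, hx⟩ := (add_eq_zero_iff_of_nonneg (abs_nonneg _) (abs_nonneg _)).1 h.symm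
    rw [abs_eq_zero.1 hx, abs_eq_zero.1 hy]
  refine ⟨|q y| • x + |q x| • y, ?_, fun i => ?_⟩
  · rw [LinearMap.mem_ker, map_add, map_smul, map_smul]
    exact abs_mul_add_abs_mul_eq_zero_of_sign_ne hq
  · rw [map_add, map_smul, map_smul]
    exact sign_mul_add_mul_of_sign_eq (abs_nonneg _) (abs_nonneg _) hpos (hp i)

theorem card_signPatterns_succ_le {m : ℕ} (q : Fin (m + 1) → Module.Dual K V) :
    #(signPatterns q) ≤ #(signPatterns (Fin.tail q)) +
      2 * #(signPatterns fun i => (Fin.tail q i).domRestrict (LinearMap.ker (q 0))) := by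
  have hhead : ∀ σ σ' : Fin (m + 1) → SignType, Fin.tail σ = Fin.tail σ' → σ 0 = σ' 0 → σ = σ' := by
    intro σ σ' htail h0
    rw [← Fin.cons_self_tail σ, ← Fin.cons_self_tail σ', htail, h0]
  refine (card_le_card_image_add_mul (f := Fin.tail) (fun τ => ?_)
    fun σ hσ σ' hσ' htail hne => ?_).trans
    (Nat.add_le_add_right (Finset.card_le_card (image_tail_signPatterns_subset q)) _)
  · have hinj : Set.InjOn (fun σ : Fin (m + 1) → SignType => σ 0)
        ({σ ∈ signPatterns q | Fin.tail σ = τ} : Finset _) := by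
      intro σ hσ σ' hσ' h0
      rw [Finset.mem_coe, Finset.mem_filter] at hσ hσ'
      exact hhead σ σ' (hσ.2.trans hσ'.2.symm) h0
    calc #{σ ∈ signPatterns q | Fin.tail σ = τ} ≤ #(Finset.univ : Finset SignType) :=
          Finset.card_le_card_of_injOn _ (fun _ _ => Finset.mem_univ _) hinj
      _ = 2 + 1 := by decide
  · obtain ⟨x, hx⟩ := mem_signPatterns.1 hσ
    obtain ⟨y, hy⟩ := mem_signPatterns.1 hσ'
    have h0 : sign (q 0 x) ≠ sign (q 0 y) := fun h0 =>
      hne (hhead σ σ' htail ((hx 0).symm.trans (h0.trans (hy 0))))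
    obtain ⟨z, hz, hsign⟩ := exists_mem_ker_sign_eq (p := Fin.tail q) h0 fun i =>
      (hx i.succ).trans ((congrFun htail i).trans (hy i.succ).symm)
    exact mem_signPatterns.2 ⟨⟨z, hz⟩, fun i => (hsign i).trans (hx i.succ)⟩

theorem card_signPatterns_le [FiniteDimensional K V] {m : ℕ} (q : Fin m → Module.Dual K V) :
    #(signPatterns q) ≤ (2 * m + 1) ^ Module.finrank K V := by
  induction m generalizing V with
  | zero =>
    calc #(signPatterns q) ≤ Fintype.card (Fin 0 → SignType) := Finset.card_le_univ _
      _ = (2 * 0 + 1) ^ Module.finrank K V := by simp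
  | succ m ih =>
    by_cases hq : q 0 = 0
    · have hinj : Set.InjOn Fin.tail (signPatterns q : Set (Fin (m + 1) → SignType)) := by
        intro σ hσ σ' hσ' htail
        obtain ⟨x, hx⟩ := mem_signPatterns.1 hσ
        obtain ⟨y, hy⟩ := mem_signPatterns.1 hσ'
        rw [← Fin.cons_self_tail σ, ← Fin.cons_self_tail σ', htail, ← hx, ← hy, hq]
        simp
      calc #(signPatterns q) = #((signPatterns q).image Fin.tail) :=
            (Finset.card_image_of_injOn hinj).symm
        _ ≤ #(signPatterns (Fin.tail q)) :=
            Finset.card_le_card (image_tail_signPatterns_subset q)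
        _ ≤ (2 * m + 1) ^ Module.finrank K V := ih _
        _ ≤ (2 * (m + 1) + 1) ^ Module.finrank K V := by gcongr; omega
    · rw [← Module.Dual.finrank_ker_add_one_of_ne_zero hq]
      set e := Module.finrank K (LinearMap.ker (q 0)) with he
      calc #(signPatterns q) ≤ (2 * m + 1) ^ (e + 1) + 2 * (2 * m + 1) ^ e := by
            refine (card_signPatterns_succ_le q).trans ?_
            gcongr
            · rw [he, Module.Dual.finrank_ker_add_one_of_ne_zero hq]
              exact ih _
            · exact ih _
        _ = (2 * (m + 1) + 1) * (2 * m + 1) ^ e := by ring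
        _ ≤ (2 * (m + 1) + 1) * (2 * (m + 1) + 1) ^ e := by gcongr; omega
        _ = (2 * (m + 1) + 1) ^ (e + 1) := (pow_succ' _ _).symm

theorem exists_signCell_representatives {ι : Type*} [Fintype ι] (Q : Finset (ι → ℝ)) :
    ∃ P : Finset (ι → ℝ), #P ≤ (2 * #Q + 1) ^ Fintype.card ι ∧ ∀ x, ∃ p ∈ P, p ∈ signCell Q x := by
  classical
  set q : Fin #Q → Module.Dual ℝ (ι → ℝ) := fun i => dotProductBilin ℝ ℝ (Q.equivFin.symm i).1
  choose! p hp using fun σ (hσ : σ ∈ signPatterns q) => mem_signPatterns.1 hσ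
  refine ⟨(signPatterns q).image p, ?_, fun x => ?_⟩
  · simpa using Finset.card_image_le.trans (card_signPatterns_le q)
  · have hσ : (fun i => sign (q i x)) ∈ signPatterns q := mem_signPatterns.2 ⟨x, fun _ => rfl⟩
    refine ⟨_, Finset.mem_image_of_mem p hσ, fun g hg => ?_⟩
    simpa [q] using hp _ hσ (Q.equivFin ⟨g, hg⟩)

end SignPatterns

section SubsetSums

theorem prod_add_one_le_two_pow {κ : Type*} (s : Finset κ) (a : κ → ℕ) (k : ℕ) :
    ∏ c ∈ s, (a c + 1) ≤ 2 ^ (k * #s + (∑ c ∈ s, a c) / 2 ^ k) := by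
  have hterm : ∀ c, a c + 1 ≤ 2 ^ (k + a c / 2 ^ k) := fun c =>
    calc a c + 1 ≤ 2 ^ k * (a c / 2 ^ k + 1) := Nat.lt_mul_div_succ _ (by positivity)
      _ ≤ 2 ^ k * 2 ^ (a c / 2 ^ k) := by gcongr; exact Nat.lt_two_pow_self
      _ = 2 ^ (k + a c / 2 ^ k) := (pow_add _ _ _).symm
  have hdiv : ∑ c ∈ s, a c / 2 ^ k ≤ (∑ c ∈ s, a c) / 2 ^ k := by
    rw [Nat.le_div_iff_mul_le (by positivity), Finset.sum_mul]
    exact Finset.sum_le_sum fun c _ => Nat.div_mul_le_self _ _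
  calc ∏ c ∈ s, (a c + 1) ≤ ∏ c ∈ s, 2 ^ (k + a c / 2 ^ k) :=
        Finset.prod_le_prod' fun c _ => hterm c
    _ = 2 ^ (k * #s + ∑ c ∈ s, a c / 2 ^ k) := by
        rw [Finset.prod_pow_eq_pow_sum, Finset.sum_add_distrib, Finset.sum_const, smul_eq_mul,
          Nat.mul_comm]
    _ ≤ 2 ^ (k * #s + (∑ c ∈ s, a c) / 2 ^ k) := by gcongr; exact one_le_two

theorem sum_mem_Icc_sum_min_sum_max {κ M : Type*} [AddCommGroup M] [LinearOrder M]
    [IsOrderedAddMonoid M] {s A : Finset κ} (hA : A ⊆ s) (f : κ → M) :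
    ∑ i ∈ A, f i ∈ Set.Icc (∑ i ∈ s, min (f i) 0) (∑ i ∈ s, max (f i) 0) := by
  constructor
  · calc ∑ i ∈ s, min (f i) 0 ≤ ∑ i ∈ A, min (f i) 0 :=
          Finset.sum_le_sum_of_subset_of_nonpos' hA fun _ _ _ => min_le_right _ _
      _ ≤ ∑ i ∈ A, f i := Finset.sum_le_sum fun _ _ => min_le_left _ _
  · calc ∑ i ∈ A, f i ≤ ∑ i ∈ A, max (f i) 0 := Finset.sum_le_sum fun _ _ => le_max_left _ _
      _ ≤ ∑ i ∈ s, max (f i) 0 :=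
          Finset.sum_le_sum_of_subset_of_nonneg hA fun _ _ _ => le_max_right _ _

theorem exists_ne_subset_sum_eq {κ ι : Type*} [Fintype ι] {s : Finset κ} {g : κ → ι → ℤ} {t : ℕ}
    (hg : ∀ i ∈ s, ∑ c, (g i c).natAbs ≤ 2 ^ t) (hs : 2 * (t + 1) * Fintype.card ι < #s) :
    ∃ A ⊆ s, ∃ B ⊆ s, A ≠ B ∧ ∑ i ∈ A, g i = ∑ i ∈ B, g i := by
  classical
  set box : Finset (ι → ℤ) := Fintype.piFinset fun c =>
    Finset.Icc (∑ i ∈ s, min (g i c) 0) (∑ i ∈ s, max (g i c) 0) with hbox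
  have hside : ∀ c, #(Finset.Icc (∑ i ∈ s, min (g i c) 0) (∑ i ∈ s, max (g i c) 0)) =
      ∑ i ∈ s, (g i c).natAbs + 1 := by
    intro c
    have hsum : ∑ i ∈ s, max (g i c) 0 - ∑ i ∈ s, min (g i c) 0 =
        (∑ i ∈ s, (g i c).natAbs : ℕ) := by
      rw [← Finset.sum_sub_distrib, Nat.cast_sum]
      exact Finset.sum_congr rfl fun i _ => by omega
    rw [Int.card_Icc]
    omega
  have htotal : ∑ c, ∑ i ∈ s, (g i c).natAbs ≤ 2 ^ t * #s := by
    rw [Finset.sum_comm, Nat.mul_comm]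
    exact Finset.sum_le_card_nsmul _ _ _ hg
  have hcard : #box < #s.powerset := by
    calc #box = ∏ c, (∑ i ∈ s, (g i c).natAbs + 1) := by
          rw [hbox, Fintype.card_piFinset, Finset.prod_congr rfl fun c _ => hside c]
      _ ≤ 2 ^ ((t + 1) * Fintype.card ι + (∑ c, ∑ i ∈ s, (g i c).natAbs) / 2 ^ (t + 1)) :=
          prod_add_one_le_two_pow _ _ _
      _ ≤ 2 ^ ((t + 1) * Fintype.card ι + #s / 2) := by
          rw [pow_succ, ← Nat.div_div_eq_div_mul]
          gcongr
          · exact one_le_two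
          · exact Nat.div_le_of_le_mul htotal
      _ < 2 ^ #s := by
          refine Nat.pow_lt_pow_right one_lt_two ?_
          rw [mul_assoc] at hs
          omega
      _ = #s.powerset := (Finset.card_powerset s).symm
  have hmaps : Set.MapsTo (fun A => ∑ i ∈ A, g i) (s.powerset : Set (Finset κ)) box := by
    intro A hA
    refine Finset.mem_coe.2 (Fintype.mem_piFinset.2 fun c => ?_)
    simpa only [Finset.sum_apply, Finset.mem_Icc, Set.mem_Icc] using
      sum_mem_Icc_sum_min_sum_max (Finset.mem_powerset.1 hA) fun i => g i c
  obtain ⟨A, hA, B, hB, hne, hsum⟩ := Finset.exists_ne_map_eq_of_card_lt_of_maps_to hcard hmaps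
  exact ⟨A, Finset.mem_powerset.1 hA, B, Finset.mem_powerset.1 hB, hne, hsum⟩

/-- Cancelling the common increments above the last index `q` at which `A` and `B` differ expresses
`v (q + 1) - v q` through earlier increments. -/
theorem exists_eq_add_sum_add_sum {M : Type*} [AddCommGroup M] {v : ℕ → M} {p : ℕ} {A B : Finset ℕ}
    (hA : A ⊆ Finset.range p) (hB : B ⊆ Finset.range p) (hne : A ≠ B)
    (hsum : ∑ i ∈ A, (v (i + 1) - v i) = ∑ i ∈ B, (v (i + 1) - v i)) :
    ∃ q < p, ∃ A' ⊆ Finset.range q, ∃ B' ⊆ Finset.range q,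
      v (q + 1) = v 0 + ∑ i ∈ A', (v (i + 1) - v i) + ∑ i ∈ B', (v (i + 1) - v i) := by
  obtain ⟨q, hq, hmax⟩ := Finset.exists_max_image (symmDiff A B) id
    (Finset.nonempty_iff_ne_empty.2 fun h => hne (symmDiff_eq_bot.1 h))
  wlog hqA : q ∈ A ∧ q ∉ B generalizing A B
  · refine this hB hA hne.symm hsum.symm (symmDiff_comm A B ▸ hq) (symmDiff_comm A B ▸ hmax) ?_
    exact (Finset.mem_symmDiff.1 hq).resolve_left hqA
  have habove : ∀ i, q < i → (i ∈ A ↔ i ∈ B) := by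
    intro i hi
    by_contra hAB
    exact (hmax i (Finset.mem_symmDiff.2 (by tauto))).not_gt hi
  set d : ℕ → M := fun i => v (i + 1) - v i with hd
  have hlast : d q + ∑ i ∈ Finset.range q with i ∈ A, d i =
      ∑ i ∈ Finset.range q with i ∈ B, d i := by
    have hAq : {i ∈ A | ¬q < i} = insert q {i ∈ Finset.range q | i ∈ A} := by
      ext i
      simp only [Finset.mem_filter, Finset.mem_insert, Finset.mem_range]
      grind
    have hBq : {i ∈ B | ¬q < i} = {i ∈ Finset.range q | i ∈ B} := by
      ext i
      simp only [Finset.mem_filter, Finset.mem_range]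
      grind
    have hAB : {i ∈ A | q < i} = {i ∈ B | q < i} := by
      ext i
      simp only [Finset.mem_filter]
      grind
    rw [← Finset.sum_filter_add_sum_filter_not A (q < ·),
      ← Finset.sum_filter_add_sum_filter_not B (q < ·), hAB, hAq, hBq,
      Finset.sum_insert (by simp)] at hsum
    exact add_left_cancel hsum
  refine ⟨q, Finset.mem_range.1 (hA hqA.1), {i ∈ Finset.range q | i ∈ B}, Finset.filter_subset _ _,
    {i ∈ Finset.range q | i ∉ A}, Finset.filter_subset _ _, ?_⟩
  calc v (q + 1) = v 0 + (∑ i ∈ Finset.range q, d i + d q) := by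
        rw [← Finset.sum_range_succ, Finset.sum_range_sub]
        abel
    _ = _ := by
        rw [← hlast, ← Finset.sum_filter_add_sum_filter_not (Finset.range q) (· ∈ A)]
        abel

end SubsetSums

section InferenceDimension

/-- A closure-like operation `cl` has inference dimension at most `d` on `V` if every subset of `V`
with at least `d` elements has an element in the closure of the others. -/
def InferenceDimLE {α : Type*} (cl : Set α → Set α) (V : Finset α) (d : ℕ) : Prop :=
  ∀ T ⊆ V, d ≤ #T → ∃ v ∈ T, v ∈ cl (T \ {v})

theorem exists_monotoneOn_enumeration {α β : Type*} [LinearOrder β] {T : Finset α} {p : ℕ}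
    (hp : p < #T) (f : α → β) :
    ∃ v : ℕ → α, Set.MapsTo v (Set.Iic p) T ∧ Set.InjOn v (Set.Iic p) ∧
      MonotoneOn (f ∘ v) (Set.Iic p) := by
  have : NeZero #T := ⟨by omega⟩
  set σ := Tuple.sort fun i => f (T.equivFin.symm i)
  have hσ : Monotone fun i => f (T.equivFin.symm (σ i)) :=
    Tuple.monotone_sort fun i => f (T.equivFin.symm i)
  have hval : ∀ i ∈ Set.Iic p, (Fin.ofNat #T i).val = i := fun i hi =>
    Nat.mod_eq_of_lt (hi.trans_lt hp)
  refine ⟨fun i => T.equivFin.symm (σ (Fin.ofNat #T i)), fun i _ => Subtype.coe_prop _,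
    fun i hi j hj hij => ?_, fun i hi j hj hij => hσ ?_⟩
  · rw [← hval i hi, ← hval j hj,
      σ.injective (T.equivFin.symm.injective (Subtype.coe_injective hij))]
  · rwa [Fin.le_def, hval i hi, hval j hj]

theorem subset_insert_zero_sub_insert_zero {M : Type*} [AddGroup M] {S : Set M} :
    S ⊆ insert 0 S - insert 0 S := fun h hh =>
  ⟨h, .inr hh, 0, .inl rfl, sub_zero h⟩

variable {ι : Type*} [Fintype ι] {S T : Set (ι → ℝ)} {h x y : ι → ℝ}

/-- The forms whose sign at `x` is determined by the comparisons, at `x`, of the forms in `S` with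
each other and with zero. -/
def inferred (S : Set (ι → ℝ)) (x : ι → ℝ) : Set (ι → ℝ) :=
  {h | SignConstOn h (signCell (insert 0 S - insert 0 S) x)}

theorem inferred_mono (x : ι → ℝ) : Monotone (inferred · x) := fun _ _ hST _ hh =>
  hh.mono (signCell_anti (Set.sub_subset_sub (Set.insert_subset_insert hST)
    (Set.insert_subset_insert hST)))

theorem mem_signCell_self : x ∈ signCell S x := fun _ _ => rfl

theorem signConstOn_signCell : SignConstOn h (signCell S x) ↔
    ∀ y ∈ signCell S x, sign (h ⬝ᵥ y) = sign (h ⬝ᵥ x) :=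
  ⟨fun hh y hy => hh y hy x mem_signCell_self, fun hh y hy z hz => (hh y hy).trans (hh z hz).symm⟩

theorem subset_inferred : S ⊆ inferred S x := fun _ hh => signConstOn_signCell.2 fun _ hy =>
  hy _ (subset_insert_zero_sub_insert_zero hh)

theorem inferred_eq_of_mem_signCell (hy : y ∈ signCell (insert 0 S - insert 0 S) x) :
    inferred S y = inferred S x := by
  rw [inferred, inferred, signCell_eq_of_mem hy]

theorem inferred_neg (S : Set (ι → ℝ)) (x : ι → ℝ) : inferred S (-x) = inferred S x := by
  have hsub : ∀ x, inferred S (-x) ⊆ inferred S x := fun x h hh =>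
    signConstOn_signCell.2 fun y hy => by
      simpa [Left.sign_neg] using signConstOn_signCell.1 hh (-y) (neg_mem_signCell_neg hy)
  exact (hsub x).antisymm (by simpa using hsub (-x))

/-- The forms that are nonnegative at `x` and have the same sign at `y` as at `x`. -/
def agreeSubmonoid (x y : ι → ℝ) : AddSubmonoid (ι → ℝ) where
  carrier := {g | 0 ≤ g ⬝ᵥ x ∧ sign (g ⬝ᵥ y) = sign (g ⬝ᵥ x)}
  zero_mem' := by simp
  add_mem' := by
    rintro g h ⟨hg, hgy⟩ ⟨hh, hhy⟩
    rw [Set.mem_ofPred_eq, add_dotProduct, add_dotProduct]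
    refine ⟨add_nonneg hg hh, (sign_add_eq_of_sign_eq hgy.symm hhy.symm fun hsign => ?_).symm⟩
    have hg' := sign_nonneg_iff.2 hg
    have hh' := sign_nonneg_iff.2 hh
    revert hsign hg' hh'
    generalize sign (g ⬝ᵥ x) = σ
    generalize sign (h ⬝ᵥ x) = τ
    decide +revert

/-- The linear form `h` has integer coefficients with absolute values summing to at most `N`. -/
def IsIntegralOfNormLE (N : ℕ) (h : ι → ℝ) : Prop :=
  ∃ z : ι → ℤ, h = (fun c => (z c : ℝ)) ∧ ∑ c, (z c).natAbs ≤ N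

theorem exists_succ_mem_inferred {v : ℕ → ι → ℝ} {p t : ℕ}
    (hv : ∀ i ≤ p, IsIntegralOfNormLE (2 ^ t) (v i)) (hp : 2 * (t + 2) * Fintype.card ι < p)
    (h0 : 0 ≤ v 0 ⬝ᵥ x) (hmono : MonotoneOn (fun i => v i ⬝ᵥ x) (Set.Iic p)) :
    ∃ q < p, v (q + 1) ∈ inferred (v '' Set.Iic q) x := by
  choose! z hz hnorm using hv
  have hincr : ∀ i ∈ Finset.range p, ∑ c, ((z (i + 1) - z i) c).natAbs ≤ 2 ^ (t + 1) := by
    intro i hi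
    have hip := Finset.mem_range.1 hi
    calc ∑ c, ((z (i + 1) - z i) c).natAbs
        ≤ ∑ c, ((z (i + 1) c).natAbs + (z i c).natAbs) :=
          Finset.sum_le_sum fun c _ => Int.natAbs_sub_le _ _
      _ ≤ 2 ^ t + 2 ^ t := by
          rw [Finset.sum_add_distrib]
          exact Nat.add_le_add (hnorm _ hip) (hnorm _ hip.le)
      _ = 2 ^ (t + 1) := by ring
  obtain ⟨A, hA, B, hB, hne, hsum⟩ := exists_ne_subset_sum_eq hincr (by simpa using hp)
  have hcast : ∀ A ⊆ Finset.range p, ∑ i ∈ A, (v (i + 1) - v i) =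
      fun c => (((∑ i ∈ A, (z (i + 1) - z i)) c : ℤ) : ℝ) := by
    intro A hA
    ext c
    simp only [Finset.sum_apply, Pi.sub_apply, Int.cast_sum, Int.cast_sub]
    refine Finset.sum_congr rfl fun i hi => ?_
    have hip := Finset.mem_range.1 (hA hi)
    rw [hz _ hip, hz _ hip.le]
  obtain ⟨q, hqp, A', hA', B', hB', hq⟩ := exists_eq_add_sum_add_sum (v := v) hA hB hne
    (by rw [hcast A hA, hcast B hB, hsum])
  refine ⟨q, hqp, signConstOn_signCell.2 fun y hy => ?_⟩
  have hfirst : v 0 ∈ agreeSubmonoid x y :=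
    ⟨h0, hy _ (subset_insert_zero_sub_insert_zero ⟨0, Nat.zero_le _, rfl⟩)⟩
  have hstep : ∀ i ∈ Finset.range q, v (i + 1) - v i ∈ agreeSubmonoid x y := by
    intro i hi
    have hiq := Finset.mem_range.1 hi
    refine ⟨?_, hy _ (Set.sub_mem_sub (.inr ⟨i + 1, hiq, rfl⟩) (.inr ⟨i, hiq.le, rfl⟩))⟩
    rw [sub_dotProduct, sub_nonneg]
    exact hmono (hiq.trans hqp).le (Nat.succ_le_of_lt (hiq.trans hqp)) i.le_succ
  have hmem : v (q + 1) ∈ agreeSubmonoid x y := hq ▸ add_mem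
    (add_mem hfirst (sum_mem fun i hi => hstep i (hA' hi))) (sum_mem fun i hi => hstep i (hB' hi))
  exact hmem.2

theorem exists_mem_inferred_of_nonneg {T : Finset (ι → ℝ)} {t : ℕ}
    (hT : ∀ h ∈ T, IsIntegralOfNormLE (2 ^ t) h) (hx : ∀ h ∈ T, 0 ≤ h ⬝ᵥ x)
    (hcard : 2 * (t + 2) * Fintype.card ι + 1 < #T) :
    ∃ h ∈ T, h ∈ inferred (T \ {h}) x := by
  obtain ⟨v, hmaps, hinj, hmono⟩ := exists_monotoneOn_enumeration hcard fun h => h ⬝ᵥ x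
  obtain ⟨q, hq, hinf⟩ := exists_succ_mem_inferred (fun i hi => hT _ (hmaps hi))
    (Nat.lt_succ_self _) (hx _ (hmaps (Nat.zero_le _))) hmono
  refine ⟨v (q + 1), hmaps (Set.mem_Iic.2 hq), inferred_mono x ?_ hinf⟩
  rintro _ ⟨i, hi, rfl⟩
  have hiq : i < q + 1 := Nat.lt_succ_of_le hi
  exact ⟨hmaps (hiq.le.trans hq), hinj.ne (hiq.le.trans hq) hq hiq.ne⟩

theorem inferenceDimLE_inferred {V : Finset (ι → ℝ)} {t : ℕ}
    (hV : ∀ h ∈ V, IsIntegralOfNormLE (2 ^ t) h) (x : ι → ℝ) :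
    InferenceDimLE (inferred · x) V (4 * (t + 2) * Fintype.card ι + 4) := by
  classical
  intro T hTV hcard
  wlog hhalf : 2 * (t + 2) * Fintype.card ι + 1 < #{h ∈ T | 0 ≤ h ⬝ᵥ x} generalizing x
  · have hneg : #{h ∈ T | ¬0 ≤ h ⬝ᵥ x} ≤ #{h ∈ T | 0 ≤ h ⬝ᵥ (-x)} := by
      refine Finset.card_le_card fun h hh => ?_
      rw [Finset.mem_filter] at hh ⊢
      exact ⟨hh.1, by rw [dotProduct_neg]; linarith [hh.2]⟩
    have hsplit := Finset.card_filter_add_card_filter_not (s := T) fun h => 0 ≤ h ⬝ᵥ x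
    simp only [mul_assoc] at hcard hhalf
    simpa only [inferred_neg] using this (-x) (by simp only [mul_assoc]; omega)
  obtain ⟨h, hh, hinf⟩ := exists_mem_inferred_of_nonneg
    (fun h hh => hV h (hTV (Finset.filter_subset _ _ hh))) (fun h hh => (Finset.mem_filter.1 hh).2)
    hhalf
  exact ⟨h, Finset.filter_subset _ _ hh, inferred_mono x
    (Set.sdiff_subset_sdiff_left (Finset.coe_subset.2 (Finset.filter_subset _ _))) hinf⟩

end InferenceDimension

section Sampling

variable {α : Type*} {cl : Set α → Set α} {V S : Finset α} {d : ℕ}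

open Classical in
/-- The sample `S` is bad for `V`: its closure misses more than half of `V`. -/
def InfersFew (cl : Set α → Set α) (V S : Finset α) : Prop :=
  #V < 2 * #{v ∈ V | v ∉ cl S}

open Classical in
/-- The bad samples of size `i`, whose proportion decays geometrically in `i`. -/
noncomputable def badSamples (cl : Set α → Set α) (V : Finset α) (i : ℕ) : Finset (Finset α) :=
  {S ∈ V.powersetCard i | InfersFew cl V S}

theorem mem_badSamples {i : ℕ} :
    S ∈ badSamples cl V i ↔ (S ⊆ V ∧ #S = i) ∧ InfersFew cl V S := by
  simp only [badSamples, Finset.mem_filter, Finset.mem_powersetCard]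

theorem InfersFew.of_superset (hcl : Monotone cl) {T : Finset α} (hST : S ⊆ T)
    (hT : InfersFew cl V T) : InfersFew cl V S := by
  classical
  refine hT.trans_le (Nat.mul_le_mul_left 2 (Finset.card_le_card fun v hv => ?_))
  rw [Finset.mem_filter] at hv ⊢
  exact ⟨hv.1, fun hvS => hv.2 (hcl (Finset.coe_subset.2 hST) hvS)⟩

open Classical in
theorem card_filter_notMem_cl_erase_lt (hcl : Monotone cl) (hdim : InferenceDimLE cl V d)
    (hSV : S ⊆ V) : #{v ∈ S | v ∉ cl (S \ {v})} < d := by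
  by_contra! hge
  obtain ⟨v, hv, hvcl⟩ := hdim _ ((Finset.filter_subset _ _).trans hSV) hge
  exact (Finset.mem_filter.1 hv).2
    (hcl (Set.sdiff_subset_sdiff_left (Finset.coe_subset.2 (Finset.filter_subset _ _))) hvcl)

open Classical in
theorem InfersFew.card_filter_mem_cl_le (hext : ∀ S, S ⊆ cl S) (hSV : S ⊆ V)
    (hS : InfersFew cl V S) : #{v ∈ V \ S | v ∈ cl S} ≤ (#V - #S) / 2 := by
  have hsplit := Finset.card_filter_add_card_filter_not (s := V) fun v => v ∈ cl S
  have hmem : {v ∈ V | v ∈ cl S} = {v ∈ V \ S | v ∈ cl S} ∪ S := by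
    ext v
    have := @hext S v
    have := @hSV v
    simp only [Finset.mem_filter, Finset.mem_union, Finset.mem_sdiff, Finset.mem_coe] at *
    tauto
  have hcard : #{v ∈ V | v ∈ cl S} = #{v ∈ V \ S | v ∈ cl S} + #S := by
    rw [hmem, Finset.card_union_of_disjoint]
    exact Finset.disjoint_left.2 fun v hv =>
      (Finset.mem_sdiff.1 (Finset.mem_filter.1 hv).1).2
  have hfew : #V < 2 * #{v ∈ V | v ∉ cl S} := hS
  omega

open Classical in
/-- Double counting of the pairs `S ∪ {v}`, `S` with `v ∈ cl S`: a bad sample of size `i + 1`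
contains many elements inferred from the others, whereas a bad sample of size `i` infers few
elements outside itself. -/
theorem card_badSamples_succ_mul_le (hcl : Monotone cl) (hext : ∀ S, S ⊆ cl S)
    (hdim : InferenceDimLE cl V d) (i : ℕ) :
    #(badSamples cl V (i + 1)) * (i + 1 - d) ≤ #(badSamples cl V i) * ((#V - i) / 2) := by
  refine Finset.card_mul_le_card_mul (fun X S : Finset α => ∃ v ∉ S, v ∈ cl S ∧ X = insert v S)
    (fun X hX => ?_) fun S hS => ?_
  · obtain ⟨⟨hXV, hXcard⟩, hbad⟩ := mem_badSamples.1 hX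
    have hsplit := Finset.card_filter_add_card_filter_not (s := X) fun v => v ∈ cl (X \ {v})
    have hlt := card_filter_notMem_cl_erase_lt hcl hdim hXV
    calc i + 1 - d ≤ #{v ∈ X | v ∈ cl (X \ {v})} := by omega
      _ = #({v ∈ X | v ∈ cl (X \ {v})}.image X.erase) := by
        refine (Finset.card_image_of_injOn fun v hv w hw => ?_).symm
        exact Finset.erase_injOn X (Finset.mem_filter.1 hv).1 (Finset.mem_filter.1 hw).1
      _ ≤ _ := by
        refine Finset.card_le_card fun S hS => ?_
        obtain ⟨v, hv, rfl⟩ := Finset.mem_image.1 hS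
        obtain ⟨hvX, hvcl⟩ := Finset.mem_filter.1 hv
        refine (Finset.mem_bipartiteAbove _).2 ⟨mem_badSamples.2 ⟨⟨?_, ?_⟩, ?_⟩, v,
          Finset.notMem_erase v X, Finset.coe_erase v X ▸ hvcl, (Finset.insert_erase hvX).symm⟩
        · exact (Finset.erase_subset _ _).trans hXV
        · rw [Finset.card_erase_of_mem hvX, hXcard, Nat.add_sub_cancel]
        · exact hbad.of_superset hcl (Finset.erase_subset _ _)
  · obtain ⟨⟨hSV, rfl⟩, hbad⟩ := mem_badSamples.1 hS
    calc _ ≤ #({v ∈ V \ S | v ∈ cl S}.image fun v => insert v S) := by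
          refine Finset.card_le_card fun X hX => ?_
          obtain ⟨hX, v, hvS, hvcl, rfl⟩ := (Finset.mem_bipartiteBelow _).1 hX
          have hvV := (mem_badSamples.1 hX).1.1 (Finset.mem_insert_self v S)
          exact Finset.mem_image_of_mem _
            (Finset.mem_filter.2 ⟨Finset.mem_sdiff.2 ⟨hvV, hvS⟩, hvcl⟩)
      _ ≤ #{v ∈ V \ S | v ∈ cl S} := Finset.card_image_le
      _ ≤ (#V - #S) / 2 := hbad.card_filter_mem_cl_le hext hSV

theorem card_badSamples_mul_le (hcl : Monotone cl) (hext : ∀ S, S ⊆ cl S)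
    (hdim : InferenceDimLE cl V d) (k : ℕ) :
    #(badSamples cl V (3 * d + k)) * 4 ^ k ≤ 3 ^ k * (#V).choose (3 * d + k) := by
  induction k with
  | zero =>
    classical
    simpa [badSamples] using
      (Finset.card_filter_le _ _).trans (Finset.card_powersetCard (3 * d) V).le
  | succ k ih =>
    rw [← Nat.add_assoc]
    set i := 3 * d + k
    set b := #(badSamples cl V i)
    set b' := #(badSamples cl V (i + 1))
    have hstep : 4 * (b' * (i + 1)) ≤ 3 * (b * (#V - i)) := by
      have hdouble : b' * (i + 1 - d) ≤ b * ((#V - i) / 2) :=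
        card_badSamples_succ_mul_le hcl hext hdim i
      calc 4 * (b' * (i + 1)) = 2 * (b' * (2 * (i + 1))) := by ring
        _ ≤ 2 * (b' * (3 * (i + 1 - d))) := by gcongr 2 * (b' * ?_); omega
        _ = 6 * (b' * (i + 1 - d)) := by ring
        _ ≤ 6 * (b * ((#V - i) / 2)) := by gcongr
        _ = 3 * (b * ((#V - i) / 2 * 2)) := by ring
        _ ≤ 3 * (b * (#V - i)) := by gcongr; exact Nat.div_mul_le_self _ _
    refine Nat.le_of_mul_le_mul_right (c := i + 1) ?_ (Nat.succ_pos i)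
    calc b' * 4 ^ (k + 1) * (i + 1) = 4 * (b' * (i + 1)) * 4 ^ k := by ring
      _ ≤ 3 * (b * (#V - i)) * 4 ^ k := by gcongr
      _ = 3 * (#V - i) * (b * 4 ^ k) := by ring
      _ ≤ 3 * (#V - i) * (3 ^ k * (#V).choose i) := by gcongr
      _ = 3 ^ (k + 1) * ((#V).choose i * (#V - i)) := by ring
      _ = 3 ^ (k + 1) * (#V).choose (i + 1) * (i + 1) := by
        rw [← Nat.choose_succ_right_eq, mul_assoc]

theorem card_badSamples_mul_two_pow_le (hcl : Monotone cl) (hext : ∀ S, S ⊆ cl S)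
    (hdim : InferenceDimLE cl V d) (n : ℕ) :
    #(badSamples cl V (3 * d + 3 * n)) * 2 ^ n ≤ (#V).choose (3 * d + 3 * n) := by
  refine Nat.le_of_mul_le_mul_right (c := 32 ^ n) ?_ (by positivity)
  calc #(badSamples cl V (3 * d + 3 * n)) * 2 ^ n * 32 ^ n
      = #(badSamples cl V (3 * d + 3 * n)) * 4 ^ (3 * n) := by
        rw [mul_assoc, ← mul_pow, pow_mul]
        norm_num
    _ ≤ 3 ^ (3 * n) * (#V).choose (3 * d + 3 * n) := card_badSamples_mul_le hcl hext hdim _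
    _ ≤ (#V).choose (3 * d + 3 * n) * 32 ^ n := by
        rw [Nat.mul_comm, pow_mul]
        gcongr
        norm_num

open Classical in
/-- Averaging over all samples of a fixed size makes one sample good for most points of `X` at
once. -/
theorem exists_sample_card_infersFew_mul_le {β : Type*} {cl : β → Set α → Set α}
    (hcl : ∀ x, Monotone (cl x)) (hext : ∀ x S, S ⊆ cl x S)
    (hdim : ∀ x, InferenceDimLE (cl x) V d) (X : Finset β) (n : ℕ) :
    ∃ S ⊆ V, #S ≤ 3 * d + 3 * n ∧ #{x ∈ X | InfersFew (cl x) V S} * 2 ^ n ≤ #X := by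
  rcases le_or_gt #V (3 * d + 3 * n) with hV | hV
  · refine ⟨V, subset_rfl, hV, ?_⟩
    have hall : ∀ x, {v ∈ V | v ∉ cl x V} = ∅ := fun x =>
      Finset.filter_false_of_mem fun v hv => not_not.2 (hext x V hv)
    simp [InfersFew, hall]
  set P := V.powersetCard (3 * d + 3 * n)
  have hP : P.Nonempty := Finset.powersetCard_nonempty.2 hV.le
  suffices hsum : ∑ S ∈ P, #{x ∈ X | InfersFew (cl x) V S} * 2 ^ n ≤ ∑ _S ∈ P, #X by
    obtain ⟨S, hS, hle⟩ := Finset.exists_le_of_sum_le hP hsum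
    obtain ⟨hSV, hScard⟩ := Finset.mem_powersetCard.1 hS
    exact ⟨S, hSV, hScard.le, hle⟩
  calc ∑ S ∈ P, #{x ∈ X | InfersFew (cl x) V S} * 2 ^ n
      = ∑ x ∈ X, #(badSamples (cl x) V (3 * d + 3 * n)) * 2 ^ n := by
        rw [← Finset.sum_mul, ← Finset.sum_mul]
        exact congrArg (· * 2 ^ n) (Finset.sum_card_bipartiteAbove_eq_sum_card_bipartiteBelow
          fun S x => InfersFew (cl x) V S)
    _ ≤ ∑ _x ∈ X, #P := by
        rw [Finset.card_powersetCard]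
        exact Finset.sum_le_sum fun x _ =>
          card_badSamples_mul_two_pow_le (hcl x) (hext x) (hdim x) n
    _ = ∑ _S ∈ P, #X := by
        rw [Finset.sum_const, Finset.sum_const, smul_eq_mul, smul_eq_mul, mul_comm]

end Sampling

section Orthant

/-- All coefficients of `q` lie in `{-1, 0, 1}`. -/
def IsSignVector {ι : Type*} (q : ι → ℝ) : Prop :=
  ∀ c, q c = -1 ∨ q c = 0 ∨ q c = 1

/-- The closed orthant of vectors whose coefficients are nonnegative on `J` and nonpositive off
`J`. -/
def orthant {ι : Type*} (J : Finset ι) : Set (ι → ℝ) :=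
  {h | (∀ c ∈ J, 0 ≤ h c) ∧ ∀ c ∉ J, h c ≤ 0}

theorem zero_mem_orthant {ι : Type*} (J : Finset ι) : (0 : ι → ℝ) ∈ orthant J :=
  ⟨fun _ _ => le_rfl, fun _ _ => le_rfl⟩

theorem IsSignVector.sub_of_mem_orthant {ι : Type*} {J : Finset ι} {g h : ι → ℝ}
    (hg : IsSignVector g) (hh : IsSignVector h) (hgJ : g ∈ orthant J) (hhJ : h ∈ orthant J) :
    IsSignVector (g - h) := fun c => by
  have hsign : 0 ≤ g c ∧ 0 ≤ h c ∨ g c ≤ 0 ∧ h c ≤ 0 := by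
    by_cases hc : c ∈ J
    · exact .inl ⟨hgJ.1 c hc, hhJ.1 c hc⟩
    · exact .inr ⟨hgJ.2 c hc, hhJ.2 c hc⟩
  have hgc := hg c
  have hhc := hh c
  rw [Pi.sub_apply]
  grind

theorem IsSparse.sub {ι : Type} {s t : ℕ} {g h : ι → ℝ} (hg : IsSparse s g) (hh : IsSparse t h) :
    IsSparse (s + t) (g - h) := by
  rw [IsSparse, Nat.cast_add]
  exact (Set.encard_le_encard (Function.support_sub g h)).trans
    ((Set.encard_union_le _ _).trans (add_le_add hg hh))

variable {ι : Type} [Fintype ι] {s : ℕ} {h : ι → ℝ}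

theorem isSparse_iff_card_le : IsSparse s h ↔ #{c | h c ≠ 0} ≤ s := by
  have hsupp : Function.support h = ({c | h c ≠ 0} : Finset ι) := by
    ext c
    simp
  rw [IsSparse, hsupp, Set.encard_coe_eq_coe_finsetCard, Nat.cast_le]

theorem IsSignVector.isIntegralOfNormLE (hh : IsSignVector h) (hs : IsSparse s h) :
    IsIntegralOfNormLE s h := by
  have hcoeff : ∀ c, ∃ z : ℤ, h c = z ∧ z.natAbs ≤ if h c ≠ 0 then 1 else 0 := by
    intro c
    rcases hh c with e | e | e
    · exact ⟨-1, by simp [e], by simp [e]⟩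
    · exact ⟨0, by simp [e], by simp [e]⟩
    · exact ⟨1, by simp [e], by simp [e]⟩
  choose z hz hnorm using hcoeff
  refine ⟨z, funext hz, (Finset.sum_le_sum fun c _ => hnorm c).trans ?_⟩
  rw [← Finset.card_filter]
  exact isSparse_iff_card_le.1 hs

theorem IsIntegralOfNormLE.mono {t : ℕ} (hh : IsIntegralOfNormLE s h) (hst : s ≤ t) :
    IsIntegralOfNormLE t h :=
  hh.imp fun _ hz => ⟨hz.1, hz.2.trans hst⟩

open Classical in
theorem IsSparse.two_pow_card_le (hs : IsSparse s h) :
    2 ^ Fintype.card ι ≤ 2 ^ s * #{J : Finset ι | h ∈ orthant J} := by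
  have hIcc : ({J : Finset ι | h ∈ orthant J} : Finset (Finset ι)) =
      Finset.Icc (α := Finset ι) {c | 0 < h c} {c | 0 ≤ h c} := by
    ext J
    simp only [Finset.mem_filter_univ, Finset.mem_Icc, Finset.subset_iff]
    exact ⟨fun hJ => ⟨fun c hc => by_contra fun hcJ => (hJ.2 c hcJ).not_gt hc, hJ.1⟩,
      fun hJ => ⟨hJ.2, fun c hcJ => not_lt.1 fun hc => hcJ (hJ.1 hc)⟩⟩
  have hle : ({c | 0 < h c} : Finset ι) ⊆ ({c | 0 ≤ h c} : Finset ι) :=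
    Finset.monotone_filter_right _ fun _ _ => le_of_lt
  have hzero : #{c | h c = 0} = #{c | 0 ≤ h c} - #{c | 0 < h c} := by
    rw [← Finset.card_sdiff_of_subset hle]
    congr 1
    ext c
    simp [le_antisymm_iff, and_comm]
  have hsplit := Finset.card_filter_add_card_filter_not (s := Finset.univ) fun c => h c = 0
  have hsupp := isSparse_iff_card_le.1 hs
  rw [hIcc, Finset.card_Icc_finset hle, ← hzero, ← pow_add, ← Finset.card_univ, ← hsplit]
  exact Nat.pow_le_pow_right two_pos (by simp only [ne_eq] at hsupp; omega)

open Classical in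
theorem exists_orthant {ι : Type} [Finite ι] {s : ℕ} {R : Finset (ι → ℝ)}
    (hR : ∀ h ∈ R, IsSparse s h) :
    ∃ J : Finset ι, #R ≤ 2 ^ s * #{h ∈ R | h ∈ orthant J} := by
  have := Fintype.ofFinite ι
  suffices hsum : ∑ _J : Finset ι, #R ≤ ∑ J : Finset ι, 2 ^ s * #{h ∈ R | h ∈ orthant J} by
    obtain ⟨J, -, hJ⟩ := Finset.exists_le_of_sum_le Finset.univ_nonempty hsum
    exact ⟨J, hJ⟩
  calc ∑ _J : Finset ι, #R = ∑ _h ∈ R, 2 ^ Fintype.card ι := by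
        rw [Finset.sum_const, Finset.sum_const, Finset.card_univ, Fintype.card_finset, smul_eq_mul,
          smul_eq_mul, mul_comm]
    _ ≤ ∑ h ∈ R, 2 ^ s * #{J : Finset ι | h ∈ orthant J} :=
        Finset.sum_le_sum fun h hh => (hR h hh).two_pow_card_le
    _ = ∑ J : Finset ι, 2 ^ s * #{h ∈ R | h ∈ orthant J} := by
        rw [← Finset.mul_sum, ← Finset.mul_sum]
        exact congrArg (2 ^ s * ·) (Finset.sum_card_bipartiteAbove_eq_sum_card_bipartiteBelow
          fun h J => h ∈ orthant J)

end Orthant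

section Rounds

variable {ι : Type} [Fintype ι] {H V S : Finset (ι → ℝ)} {X Y : Set (ι → ℝ)} {x : ι → ℝ}

open Classical in
/-- The forms in `H` whose sign still varies on the region `X`. -/
noncomputable def unresolved (H : Finset (ι → ℝ)) (X : Set (ι → ℝ)) : Finset (ι → ℝ) :=
  {h ∈ H | ¬SignConstOn h X}

theorem mem_unresolved {h : ι → ℝ} : h ∈ unresolved H X ↔ h ∈ H ∧ ¬SignConstOn h X := by
  simp only [unresolved, Finset.mem_filter]

theorem unresolved_subset : unresolved H X ⊆ H := fun _ hh => (mem_unresolved.1 hh).1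

theorem unresolved_mono (hYX : Y ⊆ X) : unresolved H Y ⊆ unresolved H X := fun _ hh =>
  mem_unresolved.2 ((mem_unresolved.1 hh).imp_right (mt (·.mono hYX)))

theorem two_mul_card_unresolved_add_card_le (hV : V ⊆ unresolved H X) (hYX : Y ⊆ X)
    (hY : Y ⊆ signCell (insert 0 (S : Set (ι → ℝ)) - insert 0 (S : Set (ι → ℝ))) x)
    (hS : ¬InfersFew (inferred · x) V S) :
    2 * #(unresolved H Y) + #V ≤ 2 * #(unresolved H X) := by
  classical
  have hdisj : Disjoint (unresolved H Y) {v ∈ V | v ∈ inferred S x} :=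
    Finset.disjoint_left.2 fun h hh hinf =>
      (mem_unresolved.1 hh).2 (SignConstOn.mono (Finset.mem_filter.1 hinf).2 hY)
  have hunion : #(unresolved H Y) + #{v ∈ V | v ∈ inferred S x} ≤ #(unresolved H X) := by
    rw [← Finset.card_union_of_disjoint hdisj]
    exact Finset.card_le_card (Finset.union_subset (unresolved_mono hYX)
      ((Finset.filter_subset _ _).trans hV))
  have hsplit := Finset.card_filter_add_card_filter_not (s := V) fun v => v ∈ inferred S x
  simp only [InfersFew, not_lt] at hS
  convert_to 2 * #{v ∈ V | v ∉ inferred S x} ≤ #V at hS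
  omega

open Classical in
theorem ncard_mul_two_pow_le_or_card_unresolved_le {X : Finset (ι → ℝ)} {s n : ℕ}
    (hV : V ⊆ unresolved H X) (hVcard : #(unresolved H X) ≤ 2 ^ s * #V)
    (hfew : #{x ∈ X | InfersFew (inferred · x) V S} * 2 ^ n ≤ #X) (hYX : Y ⊆ X)
    (hY : ∀ g ∈ insert 0 (S : Set (ι → ℝ)) - insert 0 (S : Set (ι → ℝ)), SignConstOn g Y) :
    Y.ncard * 2 ^ n ≤ #X ∨
      2 ^ (s + 1) * #(unresolved H Y) ≤ (2 ^ (s + 1) - 1) * #(unresolved H X) := by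
  rcases Y.eq_empty_or_nonempty with rfl | ⟨x, hx⟩
  · simp
  have hYcell := subset_signCell hY hx
  by_cases hxfew : InfersFew (inferred · x) V S
  · left
    have hsub : Y ⊆ ({x ∈ X | InfersFew (inferred · x) V S} : Finset (ι → ℝ)) := fun y hy => by
      refine Finset.mem_coe.2 (Finset.mem_filter.2 ⟨hYX hy, ?_⟩)
      simpa only [InfersFew, inferred_eq_of_mem_signCell (hYcell hy)] using hxfew
    refine (Nat.mul_le_mul_right _ ?_).trans hfew
    rw [← Set.ncard_coe_finset]
    exact Set.ncard_le_ncard hsub (Finset.finite_toSet _)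
  · right
    have hresolved := two_mul_card_unresolved_add_card_le hV hYX hYcell hxfew
    rw [Nat.sub_mul, one_mul]
    refine Nat.le_sub_of_add_le ?_
    calc 2 ^ (s + 1) * #(unresolved H Y) + #(unresolved H X)
        ≤ 2 ^ (s + 1) * #(unresolved H Y) + 2 ^ s * #V := Nat.add_le_add_left hVcard _
      _ = 2 ^ s * (2 * #(unresolved H Y) + #V) := by ring
      _ ≤ 2 ^ s * (2 * #(unresolved H X)) := Nat.mul_le_mul_left _ hresolved
      _ = 2 ^ (s + 1) * #(unresolved H X) := by ring

/-- The sampled forms lie in a common orthant, which is why their differences are still sign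
vectors. -/
theorem refinable_round {s n m κ : ℕ} (h0 : 0 ∈ H) (hsign : ∀ h ∈ H, IsSignVector h)
    (hsparse : ∀ h ∈ H, IsSparse s h)
    (hm : 3 * (4 * (s + 2) * Fintype.card ι + 4) + 3 * n + 1 ≤ m) (hκ : m ≤ 2 ^ κ)
    (X : Finset (ι → ℝ)) :
    Refinable {q ∈ (H - H : Set (ι → ℝ)) | IsSignVector q}
      (fun Y => Y.ncard * 2 ^ n ≤ #X ∨
        2 ^ (s + 1) * #(unresolved H Y) ≤ (2 ^ (s + 1) - 1) * #(unresolved H X)) (m * κ) X := by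
  classical
  obtain ⟨J, hJ⟩ := exists_orthant fun h hh => hsparse h (unresolved_subset (X := X) hh)
  set V : Finset (ι → ℝ) := {h ∈ unresolved H X | h ∈ orthant J}
  have hVH : V ⊆ H := (Finset.filter_subset _ _).trans unresolved_subset
  obtain ⟨S, hSV, hScard, hfew⟩ := exists_sample_card_infersFew_mul_le inferred_mono
    (fun _ _ => subset_inferred) (inferenceDimLE_inferred (V := V) fun h hh =>
      ((hsign h (hVH hh)).isIntegralOfNormLE (hsparse h (hVH hh))).mono
        Nat.lt_two_pow_self.le) X n
  have hS0 : ∀ g ∈ insert 0 S, g ∈ H ∧ g ∈ orthant J := fun g hg => by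
    rcases Finset.mem_insert.1 hg with rfl | hg
    · exact ⟨h0, zero_mem_orthant J⟩
    · exact ⟨hVH (hSV hg), (Finset.mem_filter.1 (hSV hg)).2⟩
  have hcard : #(insert 0 S) ≤ m :=
    (Finset.card_insert_le 0 S).trans ((Nat.succ_le_succ hScard).trans hm)
  have hsort := refinable_insertion_sort (Q := {q ∈ (H - H : Set (ι → ℝ)) | IsSignVector q})
    (fun g hg h hh => ⟨Set.sub_mem_sub (hS0 g hg).1 (hS0 h hh).1,
      (hsign g (hS0 g hg).1).sub_of_mem_orthant (hsign h (hS0 h hh).1) (hS0 g hg).2 (hS0 h hh).2⟩)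
    (hcard.trans hκ) X
  refine (hsort.mono_depth (Nat.mul_le_mul_right κ hcard)).bind (D' := 0) fun Y hYX hY => .done ?_
  rw [Finset.coe_insert] at hY
  exact ncard_mul_two_pow_le_or_card_unresolved_le (Finset.filter_subset _ _) hJ hfew hYX hY

theorem refinable_of_rounds {Q : Set (ι → ℝ)} {n M D : ℕ}
    (hround : ∀ X : Finset (ι → ℝ), Refinable Q (fun Y => Y.ncard * 2 ^ n ≤ #X ∨
      M * #(unresolved H Y) ≤ (M - 1) * #(unresolved H X)) D X) (k r : ℕ) {X : Finset (ι → ℝ)}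
    (hX : #X ≤ (2 ^ n) ^ k) (hr : #(unresolved H X) * (M - 1) ^ r < M ^ r) :
    Refinable Q (fun Y => unresolved H Y = ∅) ((k + r) * D) X := by
  induction k generalizing r X with
  | zero =>
    refine .done (Finset.eq_empty_of_forall_notMem fun h hh => (mem_unresolved.1 hh).2 ?_)
    exact signConstOn_of_subsingleton (Finset.card_le_one_iff_subsingleton.1 (by simpa using hX))
  | succ k ihk =>
    induction r generalizing X with
    | zero => exact .done (Finset.card_eq_zero.1 (by simpa using hr))
    | succ r ihr =>
      rw [← Nat.add_assoc, Nat.succ_mul, Nat.add_comm]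
      refine (hround X).bind fun Y hYX hY => ?_
      lift Y to Finset (ι → ℝ) using X.finite_toSet.subset hYX
      rcases hY with hfew | hresolved
      · rw [Nat.add_right_comm, Nat.add_assoc]
        refine ihk (r + 1) ?_ ?_
        · rw [Set.ncard_coe_finset] at hfew
          exact Nat.le_of_mul_le_mul_right (hfew.trans hX) (by positivity)
        · exact (Nat.mul_le_mul_right _ (Finset.card_le_card (unresolved_mono hYX))).trans_lt hr
      · refine ihr ((Finset.card_le_card (Finset.coe_subset.1 hYX)).trans hX) ?_
        refine Nat.lt_of_mul_lt_mul_left (a := M) ?_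
        calc M * (#(unresolved H Y) * (M - 1) ^ r)
            = M * #(unresolved H Y) * (M - 1) ^ r := by ring
          _ ≤ (M - 1) * #(unresolved H X) * (M - 1) ^ r := Nat.mul_le_mul_right _ hresolved
          _ = #(unresolved H X) * (M - 1) ^ (r + 1) := by ring
          _ < M ^ (r + 1) := hr
          _ = M * M ^ r := by ring

end Rounds

section PointLocation

theorem exists_tree_pointLocation_of_card_le {ι : Type} [Fintype ι] {H : Finset (ι → ℝ)}
    {s m κ k r : ℕ} (h0 : 0 ∈ H) (hsign : ∀ h ∈ H, IsSignVector h)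
    (hsparse : ∀ h ∈ H, IsSparse s h)
    (hm : 3 * (4 * (s + 2) * Fintype.card ι + 4) + 3 * Fintype.card ι + 1 ≤ m) (hκ : m ≤ 2 ^ κ)
    (hk : 2 * (#H * #H) + 1 ≤ 2 ^ k) (hr : #H * (2 ^ (s + 1) - 1) ^ r < (2 ^ (s + 1)) ^ r) :
    ∃ T : LinearDecisionTree ι (↥(H : Set (ι → ℝ)) → SignType),
      T.depth ≤ (k + r) * (m * κ) ∧
      T.queries ⊆ {q ∈ (H - H : Set (ι → ℝ)) | IsSignVector q} ∧
      ∀ x, T.eval x = pointLocation H x := by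
  classical
  obtain ⟨P, hPcard, hP⟩ := exists_signCell_representatives (H - H)
  have hPcard' : #P ≤ (2 ^ Fintype.card ι) ^ k := by
    rw [pow_right_comm]
    refine hPcard.trans (Nat.pow_le_pow_left (le_trans ?_ hk) _)
    gcongr
    exact Finset.card_sub_le
  have hrefine := refinable_of_rounds (refinable_round h0 hsign hsparse hm hκ) k r hPcard'
    ((Nat.mul_le_mul_right _ (Finset.card_le_card unresolved_subset)).trans_lt hr)
  obtain ⟨T, hdepth, hqueries, heval⟩ := hrefine.exists_tree (F := pointLocation H) fun Y hY => by
    rcases Y.eq_empty_or_nonempty with rfl | ⟨y, hy⟩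
    · exact ⟨fun _ => 0, by simp⟩
    · refine ⟨pointLocation H y, fun x hx => funext fun h => ?_⟩
      have hconst : SignConstOn h.1 Y := by_contra fun hh =>
        Finset.notMem_empty h.1 (hY ▸ mem_unresolved.2 ⟨h.2, hh⟩)
      exact hconst x hx y hy
  refine ⟨T, hdepth, hqueries, fun x => ?_⟩
  obtain ⟨p, hp, hpx⟩ := hP x
  rw [Finset.coe_sub] at hpx
  rw [← T.eval_eq_of_mem_signCell (signCell_anti (hqueries.trans (Set.sep_subset _ _)) hpx),
    heval p hp]
  exact funext fun h => hpx h.1 ⟨h.1, h.2, 0, h0, sub_zero h.1⟩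

theorem two_mul_pow_self_le {a : ℕ} (ha : a ≠ 0) : 2 * a ^ a ≤ (a + 1) ^ a := by
  have hbernoulli : (2 : ℚ) ≤ (1 + 1 / a) ^ a := by
    have hinv : (0 : ℚ) ≤ 1 / a := by positivity
    have h := one_add_mul_le_pow (neg_nonpos.2 zero_le_two |>.trans hinv) a
    rwa [mul_one_div_cancel (by exact_mod_cast ha), one_add_one_eq_two] at h
  have hmul : (2 : ℚ) * a ^ a ≤ (a + 1) ^ a := by
    calc (2 : ℚ) * a ^ a ≤ (1 + 1 / a) ^ a * a ^ a := by gcongr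
      _ = (a + 1) ^ a := by
        rw [← mul_pow, add_mul, one_mul, one_div_mul_cancel (by exact_mod_cast ha)]
  exact_mod_cast hmul

theorem mul_pow_mul_size_lt {a : ℕ} (ha : a ≠ 0) (N : ℕ) :
    N * a ^ (a * N.size) < (a + 1) ^ (a * N.size) := by
  calc N * a ^ (a * N.size) < 2 ^ N.size * a ^ (a * N.size) := by
        gcongr
        exact N.lt_size_self
    _ = (2 * a ^ a) ^ N.size := by rw [mul_pow, pow_mul]
    _ ≤ ((a + 1) ^ a) ^ N.size := Nat.pow_le_pow_left (two_mul_pow_self_le ha) _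
    _ = (a + 1) ^ (a * N.size) := (pow_mul _ _ _).symm

theorem size_le_three_mul_log (N : ℕ) : (N.size : ℝ) ≤ 3 * Real.log (N + 1) := by
  rcases N.eq_zero_or_pos with rfl | hN
  · simp
  have hsize : 0 < N.size := Nat.size_pos.2 hN
  have hpow : 2 ^ (N.size - 1) ≤ N := Nat.lt_size.1 (Nat.sub_lt hsize one_pos)
  have hlog2 : Real.log 2 ≤ Real.log (N + 1) :=
    Real.log_le_log two_pos (by exact_mod_cast Nat.succ_le_succ hN)
  have hlog : (N.size - 1 : ℝ) * Real.log 2 ≤ Real.log (N + 1) := by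
    rw [← Nat.cast_pred hsize, ← Real.log_pow]
    exact Real.log_le_log (by positivity) (by exact_mod_cast hpow.trans N.le_succ)
  have hlog2_gt := Real.log_two_gt_d9
  nlinarith [(Nat.cast_nonneg N.size : (0 : ℝ) ≤ N.size)]

theorem exists_tree_pointLocation_depth_le_size (s : ℕ) :
    ∃ C : ℕ, ∀ {ι : Type} [Fintype ι] [Nonempty ι] {H : Finset (ι → ℝ)}, 0 ∈ H →
      (∀ h ∈ H, IsSignVector h) → (∀ h ∈ H, IsSparse s h) →
      ∃ T : LinearDecisionTree ι (↥(H : Set (ι → ℝ)) → SignType),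
        T.depth ≤ C * Fintype.card ι * (Fintype.card ι).size * (#H).size ∧
        T.queries ⊆ {q ∈ (H - H : Set (ι → ℝ)) | IsSignVector q} ∧
        ∀ x, T.eval x = pointLocation H x := by
  set B := 12 * s + 40 with hB
  set a := 2 ^ (s + 1) - 1
  have ha : a + 1 = 2 ^ (s + 1) := Nat.sub_add_cancel Nat.one_le_two_pow
  have ha0 : a ≠ 0 := by
    have := Nat.pow_le_pow_right two_pos (Nat.succ_le_succ s.zero_le)
    omega
  refine ⟨(a + 3) * B * (B.size + 1), fun {ι} _ _ {H} h0 hsign hsparse => ?_⟩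
  set n := Fintype.card ι
  have hn : 0 < n := Fintype.card_pos
  have hL : 0 < (#H).size := Nat.size_pos.2 (Finset.card_pos.2 ⟨0, h0⟩)
  have hm : 3 * (4 * (s + 2) * n + 4) + 3 * n + 1 ≤ B * n := by
    rw [hB]
    nlinarith
  have hκ : B * n ≤ 2 ^ (B.size + n.size) := by
    rw [pow_add]
    exact Nat.mul_le_mul B.lt_size_self.le n.lt_size_self.le
  have hk : 2 * (#H * #H) + 1 ≤ 2 ^ (2 * (#H).size + 1) := by
    have hH : #H + 1 ≤ 2 ^ (#H).size := (#H).lt_size_self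
    calc 2 * (#H * #H) + 1 ≤ 2 * ((#H + 1) * (#H + 1)) := by nlinarith
      _ ≤ 2 * (2 ^ (#H).size * 2 ^ (#H).size) := by gcongr
      _ = 2 ^ (2 * (#H).size + 1) := by ring
  have hr : #H * a ^ (a * (#H).size) < (2 ^ (s + 1)) ^ (a * (#H).size) :=
    ha ▸ mul_pow_mul_size_lt ha0 #H
  obtain ⟨T, hdepth, hT⟩ := exists_tree_pointLocation_of_card_le h0 hsign hsparse hm hκ hk hr
  refine ⟨T, ?_, hT⟩
  calc T.depth ≤ (2 * (#H).size + 1 + a * (#H).size) * (B * n * (B.size + n.size)) := hdepth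
    _ ≤ ((a + 3) * (#H).size) * (B * n * ((B.size + 1) * n.size)) := by
      have hnsize := Nat.size_pos.2 hn
      gcongr <;> nlinarith
    _ = (a + 3) * B * (B.size + 1) * n * n.size * (#H).size := by ring

theorem exists_tree_pointLocation (s : ℕ) :
    ∃ C : ℝ, 0 < C ∧ ∀ {ι : Type} [Fintype ι] [Nonempty ι] {H : Set (ι → ℝ)}, H.Finite → 0 ∈ H →
      (∀ h ∈ H, IsSignVector h) → (∀ h ∈ H, IsSparse s h) →
      ∃ T : LinearDecisionTree ι (H → SignType),
        T.depth ≤ C * Fintype.card ι * Real.log (Fintype.card ι + 1) * Real.log (H.ncard + 1) ∧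
        T.queries ⊆ {q ∈ H - H | IsSignVector q} ∧ ∀ x, T.eval x = pointLocation H x := by
  obtain ⟨C, hC⟩ := exists_tree_pointLocation_depth_le_size s
  refine ⟨9 * (C + 1), by positivity, fun {ι} _ _ {H} hfin h0 hsign hsparse => ?_⟩
  lift H to Finset (ι → ℝ) using hfin
  obtain ⟨T, hdepth, hT⟩ := hC h0 hsign hsparse
  refine ⟨T, ?_, hT⟩
  rw [Set.ncard_coe_finset]
  calc (T.depth : ℝ)
      ≤ C * Fintype.card ι * (Fintype.card ι).size * (#H).size := by exact_mod_cast hdepth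
    _ ≤ (C + 1) * Fintype.card ι * (3 * Real.log (Fintype.card ι + 1)) *
        (3 * Real.log (#H + 1)) := by
        have hlog := (Nat.cast_nonneg _).trans (size_le_three_mul_log (Fintype.card ι))
        gcongr
        · exact le_add_of_nonneg_right zero_le_one
        · exact size_le_three_mul_log _
        · exact size_le_three_mul_log _
    _ = 9 * (C + 1) * Fintype.card ι * Real.log (Fintype.card ι + 1) * Real.log (#H + 1) := by ring

end PointLocation

section Sumset

variable {n : ℕ}

theorem sumComparison_dotProduct (i j k l : Fin n) (x : Fin n ⊕ Fin n → ℝ) :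
    sumComparison i j k l ⬝ᵥ x = x (.inl i) + x (.inr j) - (x (.inl k) + x (.inr l)) := by
  simp [sumComparison, sub_dotProduct, add_dotProduct]

theorem sumComparison_self (i j : Fin n) : sumComparison i j i j = 0 :=
  sub_self _

theorem isSignVector_sumComparison (i j k l : Fin n) : IsSignVector (sumComparison i j k l) := by
  rintro (c | c) <;>
    simp only [sumComparison, Pi.sub_apply, Pi.add_apply, Pi.single_apply, Sum.inl.injEq,
      Sum.inr.injEq, reduceCtorEq, if_false] <;>
    split_ifs <;> simp

theorem isSparse_sumComparison (i j k l : Fin n) : IsSparse 4 (sumComparison i j k l) := by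
  refine isSparse_iff_card_le.2 (le_trans (Finset.card_le_card ?_) (Finset.card_le_four
    (a := Sum.inl i) (b := Sum.inr j) (c := Sum.inl k) (d := Sum.inr l)))
  intro c hc
  by_contra hne
  simp only [Finset.mem_insert, Finset.mem_singleton, not_or] at hne
  exact (Finset.mem_filter.1 hc).2 (by simp [sumComparison, hne])

theorem sumsetVectors_eq_range (n : ℕ) :
    sumsetVectors n = Set.range fun p : (Fin n × Fin n) × (Fin n × Fin n) =>
      sumComparison p.1.1 p.1.2 p.2.1 p.2.2 := by
  ext h
  simp [sumsetVectors, eq_comm]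

theorem ncard_sumsetVectors_le (n : ℕ) : (sumsetVectors n).ncard ≤ n ^ 4 := by
  rw [sumsetVectors_eq_range, ← Set.image_univ]
  refine (Set.ncard_image_le Set.finite_univ).trans (le_of_eq ?_)
  rw [Set.ncard_univ, Nat.card_eq_fintype_card]
  simp only [Fintype.card_prod, Fintype.card_fin]
  ring

theorem map_eq_sort_image {κ α β : Type*} [Fintype κ] [LinearOrder α] [LinearOrder β]
    {f : κ → α} {g : κ → β} (hfg : ∀ p q, f p < f q ↔ g p < g q) {L : List κ}
    (hL : L.map f = (Finset.univ.image f).sort (· ≤ ·)) :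
    L.map g = (Finset.univ.image g).sort (· ≤ ·) := by
  have hlt : (L.map g).Pairwise (· < ·) := by
    have hsorted := (Finset.sortedLT_sort (Finset.univ.image f)).pairwise
    rw [← hL] at hsorted
    exact List.pairwise_map.2 ((List.pairwise_map.1 hsorted).imp (hfg _ _).1)
  have heq : ∀ p q, f p = f q → g p = g q := fun p q h =>
    le_antisymm (not_lt.1 fun hlt => ((hfg q p).2 hlt).ne' h)
      (not_lt.1 fun hlt => ((hfg p q).2 hlt).ne h)
  have himage : (L.map g).toFinset = Finset.univ.image g := by
    ext z
    simp only [List.mem_toFinset, List.mem_map, Finset.mem_image, Finset.mem_univ, true_and]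
    refine ⟨fun ⟨p, _, hp⟩ => ⟨p, hp⟩, fun ⟨p, hp⟩ => ?_⟩
    have hmem : f p ∈ L.map f := by
      rw [hL, Finset.mem_sort]
      exact Finset.mem_image_of_mem f (Finset.mem_univ p)
    obtain ⟨q, hq, hqp⟩ := List.mem_map.1 hmem
    exact ⟨q, hq, (heq q p hqp).trans hp⟩
  rw [← himage]
  exact ((List.toFinset_sort (· ≤ ·) (hlt.imp LT.lt.ne)).2 (hlt.imp LT.lt.le)).symm

theorem exists_map_eq_sort_image {κ α : Type*} [Fintype κ] [LinearOrder α] (f : κ → α) :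
    ∃ L : List κ, L.map f = (Finset.univ.image f).sort (· ≤ ·) := by
  rw [← Set.mem_range, Set.range_list_map]
  intro z hz
  simpa using hz

theorem add_lt_add_iff_of_pointLocation_eq {x y : Fin n ⊕ Fin n → ℝ}
    (hxy : pointLocation (sumsetVectors n) x = pointLocation (sumsetVectors n) y)
    (p q : Fin n × Fin n) :
    x (.inl p.1) + x (.inr p.2) < x (.inl q.1) + x (.inr q.2) ↔
      y (.inl p.1) + y (.inr p.2) < y (.inl q.1) + y (.inr q.2) := by
  have hsign := congrFun hxy ⟨sumComparison p.1 p.2 q.1 q.2, p.1, p.2, q.1, q.2, rfl⟩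
  simp only [pointLocation, sumComparison_dotProduct] at hsign
  rw [← sub_neg, ← sign_eq_neg_one_iff, hsign, sign_eq_neg_one_iff, sub_neg]

theorem exists_sumset_order (n : ℕ) :
    ∃ order : (sumsetVectors n → SignType) → List (Fin n × Fin n), ∀ a b : Fin n → ℝ,
      (order (pointLocation (sumsetVectors n) (Sum.elim a b))).map (fun p => a p.1 + b p.2) =
        (Finset.univ.image a + Finset.univ.image b).sort (· ≤ ·) := by
  choose L hL using fun x : Fin n ⊕ Fin n → ℝ =>
    exists_map_eq_sort_image fun p : Fin n × Fin n => x (.inl p.1) + x (.inr p.2)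
  refine ⟨L ∘ Function.invFun (pointLocation (sumsetVectors n)), fun a b => ?_⟩
  have hsum : Finset.univ.image a + Finset.univ.image b =
      Finset.univ.image fun p : Fin n × Fin n => a p.1 + b p.2 := by
    ext z
    simp [Finset.mem_add]
  rw [hsum]
  exact map_eq_sort_image (add_lt_add_iff_of_pointLocation_eq (Function.apply_invFun_apply
    (f := pointLocation (sumsetVectors n)) (a := Sum.elim a b))) (hL _)

theorem pointLocation_sumsetVectors_of_le_one (hn : n ≤ 1) (x : Fin n ⊕ Fin n → ℝ) :
    pointLocation (sumsetVectors n) x = 0 := by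
  have := Fin.subsingleton_iff_le_one.2 hn
  funext ⟨h, i, j, k, l, hh⟩
  rw [Subsingleton.elim k i, Subsingleton.elim l j, sumComparison_self] at hh
  simp [pointLocation, hh]

theorem exists_tree_sumset_of_two_le :
    ∃ C : ℝ, 0 < C ∧ ∀ n : ℕ, 2 ≤ n →
      ∃ T : LinearDecisionTree (Fin n ⊕ Fin n) (sumsetVectors n → SignType),
        T.depth ≤ C * n * Real.log n ^ 2 ∧
        T.queries ⊆ {q ∈ sumsetVectors n - sumsetVectors n | IsSignVector q} ∧
        ∀ x, T.eval x = pointLocation (sumsetVectors n) x := by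
  obtain ⟨C, hC, hlocate⟩ := exists_tree_pointLocation 4
  refine ⟨30 * C, by positivity, fun n hn => ?_⟩
  have : NeZero n := ⟨by omega⟩
  obtain ⟨T, hdepth, hT⟩ := hlocate (H := sumsetVectors n)
    (sumsetVectors_eq_range n ▸ Set.finite_range _) ⟨0, 0, 0, 0, (sumComparison_self 0 0).symm⟩
    (by rintro _ ⟨i, j, k, l, rfl⟩; exact isSignVector_sumComparison i j k l)
    (by rintro _ ⟨i, j, k, l, rfl⟩; exact isSparse_sumComparison i j k l)
  refine ⟨T, hdepth.trans ?_, hT⟩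
  have hdim : Real.log ((2 * n : ℕ) + 1) ≤ 3 * Real.log n := by
    rw [← Nat.cast_ofNat (n := 3), ← Real.log_pow]
    refine Real.log_le_log (by positivity) ?_
    have hpow : 2 * n + 1 ≤ n ^ 3 := by
      nlinarith [Nat.mul_le_mul hn hn, Nat.mul_le_mul_right n (Nat.mul_le_mul hn hn)]
    exact_mod_cast hpow
  have hcard : Real.log ((sumsetVectors n).ncard + 1) ≤ 5 * Real.log n := by
    rw [← Nat.cast_ofNat (n := 5), ← Real.log_pow]
    refine Real.log_le_log (by positivity) ?_
    have hpow : n ^ 4 + 1 ≤ n ^ 5 := by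
      rw [pow_succ n 4]
      nlinarith [Nat.one_le_pow 4 n (by omega)]
    exact_mod_cast (Nat.succ_le_succ (ncard_sumsetVectors_le n)).trans hpow
  have hlogcard : 0 ≤ Real.log ((sumsetVectors n).ncard + 1) := Real.log_nonneg (by simp)
  rw [Fintype.card_sum, Fintype.card_fin, ← two_mul]
  calc C * (2 * n : ℕ) * Real.log ((2 * n : ℕ) + 1) * Real.log ((sumsetVectors n).ncard + 1)
      ≤ C * (2 * n : ℕ) * (3 * Real.log n) * (5 * Real.log n) := by gcongr
    _ = 30 * C * n * Real.log n ^ 2 := by push_cast; ring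

theorem exists_tree_sumset :
    ∃ C : ℝ, 0 < C ∧ ∀ n : ℕ,
      ∃ T : LinearDecisionTree (Fin n ⊕ Fin n) (sumsetVectors n → SignType),
        T.depth ≤ C * n * Real.log n ^ 2 ∧
        T.queries ⊆ {q ∈ sumsetVectors n - sumsetVectors n | IsSignVector q} ∧
        ∀ x, T.eval x = pointLocation (sumsetVectors n) x := by
  obtain ⟨C, hC, hT⟩ := exists_tree_sumset_of_two_le
  refine ⟨C, hC, fun n => ?_⟩
  rcases le_or_gt n 1 with hn | hn
  · refine ⟨.leaf 0, ?_, Set.empty_subset _, fun x => ?_⟩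
    · rw [LinearDecisionTree.depth, Nat.cast_zero]
      positivity
    · rw [pointLocation_sumsetVectors_of_le_one hn, LinearDecisionTree.eval]
  · exact hT n hn

end Sumset

theorem mainTheorem6 :
    ∃ C : ℝ, 0 < C ∧ ∀ n : ℕ,
      ∃ T : LinearDecisionTree (Fin n ⊕ Fin n) (sumsetVectors n → SignType),
        T.IsComparisonTree (sumsetVectors n) ∧
        (∀ q ∈ T.queries, IsSparse 8 q ∧ ∀ c, q c = -1 ∨ q c = 0 ∨ q c = 1) ∧
        (T.depth : ℝ) ≤ C * n * Real.log n ^ 2 ∧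
        (∀ x : Fin n ⊕ Fin n → ℝ, T.eval x = pointLocation (sumsetVectors n) x) ∧
        ∃ order : (sumsetVectors n → SignType) → List (Fin n × Fin n),
          ∀ A B : Finset ℝ, A.card = n → B.card = n →
            ∀ a b : Fin n → ℝ, Finset.univ.image a = A → Finset.univ.image b = B →
              (order (T.eval (Sum.elim a b))).map (fun p => a p.1 + b p.2)
                = (A + B).sort (· ≤ ·) := by
  obtain ⟨C, hC, htree⟩ := exists_tree_sumset
  refine ⟨C, hC, fun n => ?_⟩
  obtain ⟨T, hdepth, hqueries, heval⟩ := htree n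
  obtain ⟨order, horder⟩ := exists_sumset_order n
  refine ⟨T, fun q hq => ?_, fun q hq => ⟨?_, (hqueries hq).2⟩, hdepth, heval, order, ?_⟩
  · obtain ⟨g, hg, h, hh, rfl⟩ := (hqueries hq).1
    exact .inr ⟨g, hg, h, hh, rfl⟩
  · obtain ⟨_, ⟨i, j, k, l, rfl⟩, _, ⟨i', j', k', l', rfl⟩, rfl⟩ := (hqueries hq).1
    exact (isSparse_sumComparison i j k l).sub (isSparse_sumComparison i' j' k' l')
  · rintro _ _ - - a b rfl rfl
    rw [heval, horder]
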